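/- Let $n\ge 1$ and let $K\subset\mathbb R^n$ be a convex body (a compact convex set with nonempty interior), with support function $h_K(v)=\max\{v\cdot y:y\in K\}$, and let $q>0$ be real. Write $\omega_n$ for the volume of the unit ball, $du$ for spherical Lebesgue measure on $S^{n-1}$ (of total mass $n\omega_n$) and $\mathcal H^{n-1}$ for $(n-1)$-dimensional Hausdorff measure. For $z\in K$ and $u\in S^{n-1}$ let $\rho_{K,z}(u)=\max\{t\in\mathbb R: z+tu\in K\}$, and for $p\in\mathbb R$ let $$\widetilde V_{p}(K,z)=\frac1n\int_{\{u\in S^{n-1}:\,\rho_{K,z}(u)>0\}}\rho_{K,z}(u)^{p}\,du\in[0,\infty].$$ Let $\partial'K$ be the set of boundary points $z$ of $K$ that have exactly one outer unit normal $\nu_K(z)$, that is, exactly one $v\in S^{n-1}$ with $z\cdot v=h_K(v)$; this defines the Gauss map $\nu_K:\partial'K\to S^{n-1}$. The chord measure of $K$ is the Borel measure on $S^{n-1}$ $$F_q(K,\eta)=\frac{2q}{\omega_n}\int_{\nu_K^{-1}(\eta)}\widetilde V_{q-1}(K,z)\,d\mathcal H^{n-1}(z),$$ and, if $0\in K$,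 the cone-chord measure of $K$ is the Borel measure on $S^{n-1}$ $$G_q(K,\eta)=\frac{2q}{(n+q-1)\omega_n}\int_{\nu_K^{-1}(\eta)}(z\cdot\nu_K(z))\,\widetilde V_{q-1}(K,z)\,d\mathcal H^{n-1}(z).$$ The chord integral of $K$ is $$I_q(K)=\int_{K\cap\ell\ne\varnothing}|K\cap\ell|^q\,d\ell,\qquad d\ell=\frac1{n\omega_n}\,dx\,du,$$ where $\ell=x+\mathbb Ru$ runs over the lines of $\mathbb R^n$ (with $u\in S^{n-1}$, $x\in u^\perp$ and $dx$ Lebesgue measure on $u^\perp$) and $|K\cap\ell|$ is the length of the chord $K\cap\ell$. Then the measure $F_q(K,\cdot)$ is finite, $I_q(K)$ is finite, $h_K$ is integrable with respect to $F_q(K,\cdot)$, and $$I_q(K)=\frac1{n+q-1}\int_{S^{n-1}}h_K(v)\,dF_q(K,v).$$ If moreover $K$ contains the origin (not necessarily in its interior), then $I_q(K)=G_q(K,S^{n-1})$. -/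

import Mathlib

open MeasureTheory Metric Set
open scoped ENNReal RealInnerProductSpace

noncomputable section

namespace ChordMeasure

/-- Euclidean space of dimension `n`. -/
abbrev E (n : ℕ) : Type := EuclideanSpace ℝ (Fin n)

/-- The unit sphere of `E n`, with the Borel structure of a subspace. -/
abbrev S (n : ℕ) : Type := sphere (0 : E n) 1

variable {n : ℕ}

/-- The volume `ω_n` of the unit ball. -/
def omega (n : ℕ) : ℝ := volume.real (closedBall (0 : E n) 1)

/-- Spherical Lebesgue measure `du`, of total mass `n ω_n`. -/
def sphereMeasure (n : ℕ) : Measure (S n) := (volume : Measure (E n)).toSphere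

/-- The support function `h_K(v) = max {v ⬝ y : y ∈ K}`. -/
def supportFn (K : ConvexBody (E n)) (v : E n) : ℝ :=
  sSup ((fun y => ⟪v, y⟫) '' (K : Set (E n)))

/-- The extended radial function `ρ_{K,z}(u) = max {t : z + t u ∈ K}`; it is `0` when no such `t`
exists, since `sSup ∅ = 0`. -/
def radialFn (K : ConvexBody (E n)) (z u : E n) : ℝ :=
  sSup {t : ℝ | z + t • u ∈ K}

/-- The dual quermassintegral with real index `p` with respect to a point `z ∈ K`: the integral of
`ρ_{K,z}(u) ^ p / n` over those `u` in the sphere where `ρ_{K,z}(u)` is positive.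
It may be infinite for negative `p` and `z` in the boundary of `K`. -/
def dualQuermass (p : ℝ) (K : ConvexBody (E n)) (z : E n) : ℝ≥0∞ :=
  (n : ℝ≥0∞)⁻¹ * ∫⁻ u in {u : S n | 0 < radialFn K z u},
    ENNReal.ofReal (radialFn K z u ^ p) ∂(sphereMeasure n)

/-- `v` is an outer unit normal of `K` at `z`: the point `z` lies on the supporting
hyperplane with unit normal `v`. -/
def IsNormalAt (K : ConvexBody (E n)) (z : E n) (v : S n) : Prop :=
  ⟪z, (v : E n)⟫ = supportFn K v

/-- The regular part of the boundary: boundary points with exactly one outer unit normal. -/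
def regularBoundary (K : ConvexBody (E n)) : Set (E n) :=
  {z | z ∈ frontier (K : Set (E n)) ∧ ∃! v : S n, IsNormalAt K z v}

/-- The Gauss map, sending a regular boundary point to its unique outer unit normal. -/
def gaussMap (K : ConvexBody (E n)) (z : regularBoundary K) : S n :=
  z.2.2.choose

/-- The chord measure `F_q(K, ⬝)`: the image under the Gauss map of the measure with density
`(2 q / ω_n) * dualQuermass (q - 1) K` with respect to the `(n - 1)`-dimensional Hausdorff measure
of the regular boundary (with Euclidean normalization). See `chordMeasure_apply`. -/
def chordMeasure (q : ℝ) (K : ConvexBody (E n)) : Measure (S n) :=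
  ((μHE[n - 1] : Measure (regularBoundary K)).withDensity fun z =>
    ENNReal.ofReal (2 * q / omega n) * dualQuermass (q - 1) K z).map (gaussMap K)

/-- The cone-chord measure `G_q(K, ⬝)` of a convex body containing the origin; then
`z ⬝ ν_K(z) = h_K(ν_K(z)) ≥ 0`. See `coneChordMeasure_apply`. -/
def coneChordMeasure (q : ℝ) (K : ConvexBody (E n)) : Measure (S n) :=
  ((μHE[n - 1] : Measure (regularBoundary K)).withDensity fun z =>
    ENNReal.ofReal (2 * q / ((n + q - 1) * omega n)) *
      (ENNReal.ofReal ⟪(z : E n), (gaussMap K z : E n)⟫ * dualQuermass (q - 1) K z)).map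
    (gaussMap K)

/-- Integration over the space of all affine lines with respect to the motion-invariant measure
`dℓ = (1 / (n ω_n)) dx du`, where `ℓ = x + ℝ u` with `u` in the unit sphere and `x` in the
hyperplane orthogonal to `u`, `dx` being Lebesgue measure on that hyperplane. -/
def lintegralLines (f : AffineSubspace ℝ (E n) → ℝ≥0∞) : ℝ≥0∞ :=
  (ENNReal.ofReal (n * omega n))⁻¹ *
    ∫⁻ u : S n, ∫⁻ x in ((ℝ ∙ (u : E n))ᗮ : Set (E n)),
      f (AffineSubspace.mk' x (ℝ ∙ (u : E n))) ∂(μHE[n - 1]) ∂(sphereMeasure n)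

/-- The chord integral `I_q(K)`: the integral of `|K ∩ ℓ| ^ q` over all lines `ℓ` that meet `K`. -/
def chordIntegral (q : ℝ) (K : ConvexBody (E n)) : ℝ≥0∞ :=
  lintegralLines ({ℓ : AffineSubspace ℝ (E n) | ((K : Set (E n)) ∩ ℓ).Nonempty}.indicator
    fun ℓ => μHE[1] ((K : Set (E n)) ∩ ℓ) ^ q)

theorem gaussMap_spec (K : ConvexBody (E n)) (z : regularBoundary K) :
    IsNormalAt K z (gaussMap K z) := z.2.2.choose_spec.1

theorem gaussMap_eq (K : ConvexBody (E n)) (z : regularBoundary K) {v : S n}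
    (hv : IsNormalAt K z v) : gaussMap K z = v := (z.2.2.choose_spec.2 v hv).symm

theorem isNormalAt_iff (K : ConvexBody (E n)) {z : E n} (hz : z ∈ K) (v : S n) :
    IsNormalAt K z v ↔ ∀ y ∈ K, ⟪(v : E n), y⟫ ≤ ⟪(v : E n), z⟫ := by
  have hbdd : BddAbove ((fun y => ⟪(v : E n), y⟫) '' (K : Set (E n))) :=
    (K.isCompact.image (by fun_prop)).bddAbove
  unfold IsNormalAt supportFn
  rw [real_inner_comm]
  constructor
  · intro h y hy
    rw [h]
    exact le_csSup hbdd ⟨y, hy, rfl⟩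
  · intro h
    refine le_antisymm (le_csSup hbdd ⟨z, hz, rfl⟩) (csSup_le (K.nonempty.image _) ?_)
    rintro _ ⟨y, hy, rfl⟩
    exact h y hy

theorem continuous_gaussMap (K : ConvexBody (E n)) : Continuous (gaussMap K) := by
  refine continuous_iff_isClosed.2 fun C hC => ?_
  have hN : IsClosed {p : E n × S n | ∀ y ∈ K, ⟪(p.2 : E n), y⟫ ≤ ⟪(p.2 : E n), p.1⟫} := by
    simp only [ofPred_forall]
    exact isClosed_iInter fun y => isClosed_iInter fun _ =>
      isClosed_le (by fun_prop) (by fun_prop)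
  have hcl := isClosedMap_fst_of_compactSpace _ (hN.inter (hC.preimage continuous_snd))
  have key : gaussMap K ⁻¹' C = Subtype.val ⁻¹' (Prod.fst ''
      ({p : E n × S n | ∀ y ∈ K, ⟪(p.2 : E n), y⟫ ≤ ⟪(p.2 : E n), p.1⟫} ∩
        Prod.snd ⁻¹' C)) := by
    ext z
    have hz : (z : E n) ∈ K := K.isClosed.frontier_subset z.2.1
    constructor
    · intro h
      exact ⟨(z, gaussMap K z), ⟨(isNormalAt_iff K hz _).1 (gaussMap_spec K z), h⟩, rfl⟩
    · rintro ⟨⟨x, v⟩, ⟨h1, h2⟩, rfl⟩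
      rw [mem_preimage, gaussMap_eq K z ((isNormalAt_iff K hz v).2 h1)]
      exact h2
  rw [key]
  exact hcl.preimage continuous_subtype_val

/-- The integral over `ν_K⁻¹(η)` that characterizes the chord measure. -/
theorem chordMeasure_apply (q : ℝ) (K : ConvexBody (E n)) {η : Set (S n)}
    (hη : MeasurableSet η) :
    chordMeasure q K η = ENNReal.ofReal (2 * q / omega n) *
      ∫⁻ z in gaussMap K ⁻¹' η, dualQuermass (q - 1) K z ∂(μHE[n - 1]) := by
  have hm := (continuous_gaussMap K).measurable
  rw [chordMeasure, Measure.map_apply hm hη, withDensity_apply _ (hm hη),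
    lintegral_const_mul' _ _ ENNReal.ofReal_ne_top]

/-- The integral over `ν_K⁻¹(η)` that characterizes the cone-chord measure. -/
theorem coneChordMeasure_apply (q : ℝ) (K : ConvexBody (E n)) {η : Set (S n)}
    (hη : MeasurableSet η) :
    coneChordMeasure q K η = ENNReal.ofReal (2 * q / ((n + q - 1) * omega n)) *
      ∫⁻ z in gaussMap K ⁻¹' η,
        ENNReal.ofReal ⟪(z : E n), (gaussMap K z : E n)⟫ * dualQuermass (q - 1) K z
          ∂(μHE[n - 1]) := by
  have hm := (continuous_gaussMap K).measurable
  rw [coneChordMeasure, Measure.map_apply hm hη, withDensity_apply _ (hm hη),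
    lintegral_const_mul' _ _ ENNReal.ofReal_ne_top]

end ChordMeasure

end

noncomputable section

namespace ChordMeasure

open Filter Topology Module

variable {n : ℕ}

/-! Fix an interior point `o` of `K`, let g be the gauge of `K - o`, and let P(x) be the central
projection of o + x from o to the boundary. The core is the formula with `supportAt K o` in place of
the support function; it is a computation of one integral over points and directions.

The cone measure identity (`withDensity_supportAt_eq_comap_coneMeasure`) says that (z - o)·ν dH on
the regular boundary is n times the image of volume on `K - o` under P. The boundary integral thus
becomes a volume integral of a radially constant function, and `lintegral_gauge_rpow` inserts the
weight g(x)^(q-1) at the price of the factor n + q - 1. Now g(x) ρ(P(x), u) is the distance from x,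
in direction u, to the far end of its chord in the dilate g(x)(K - o), on whose boundary x lies. For
almost every u at most one of the directions u, -u enters that dilate, so averaging over u and -u
replaces this distance by the whole chord length, with a factor 2
(`two_mul_lintegral_regularBoundary`).

Fix u and integrate over the lines parallel to u. Along such a line, the chord length at a point is
the distribution function of g evaluated at the value of g there. Almost always g has null level
sets on the line, so this quantity is uniform on (0, L], where L is the length of the chord of K,
and its (q-1)-th power integrates to L^q / q (`lintegral_line_posPow_sublevelChord`). Summing over
lines gives the chord integral.

Finiteness of the chord integral gives finiteness of the chord measure, because `supportAt K o` is
bounded below by a positive constant. The chord integral does not see o, so comparing o with t • o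
for t slightly above 1 gives ∫ o·v dF = 0 (`integral_inner_chordMeasure`), and the base point drops
out. If `K` contains the origin, its support function is nonnegative and the formula is that of the
cone-chord measure. -/

theorem euclideanHausdorffMeasure_eq_volume (n : ℕ) : (μHE[n] : Measure (E n)) = volume :=
  EuclideanSpace.euclideanHausdorffMeasure_eq_volume n

/-! ### Hausdorff measure under Lipschitz maps -/

theorem LipschitzOnWith.euclideanHausdorffMeasure_image_le {X Y : Type*} [EMetricSpace X]
    [MeasurableSpace X] [BorelSpace X] [EMetricSpace Y] [MeasurableSpace Y] [BorelSpace Y]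
    {c : NNReal} {f : X → Y} {s : Set X} (hf : LipschitzOnWith c f s) (d : ℕ) :
    μHE[d] (f '' s) ≤ (c : ℝ≥0∞) ^ d * μHE[d] s := by
  have h := hf.hausdorffMeasure_image_le (d := d) (by positivity)
  rw [ENNReal.rpow_natCast] at h
  rw [Measure.euclideanHausdorffMeasure_def, Measure.euclideanHausdorffMeasure_def,
    Measure.smul_apply, Measure.smul_apply, ENNReal.smul_def, ENNReal.smul_def, smul_eq_mul,
    smul_eq_mul, mul_left_comm]
  gcongr

theorem euclideanHausdorffMeasure_le_image_of_dist_le {X Y : Type*} [MetricSpace X]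
    [MeasurableSpace X] [BorelSpace X] [MetricSpace Y] [MeasurableSpace Y] [BorelSpace Y]
    {c : NNReal} {f : X → Y} {s : Set X}
    (hf : ∀ x ∈ s, ∀ y ∈ s, dist x y ≤ c * dist (f x) (f y)) (d : ℕ) :
    μHE[d] s ≤ (c : ℝ≥0∞) ^ d * μHE[d] (f '' s) := by
  rcases s.eq_empty_or_nonempty with rfl | ⟨x₀, hx₀⟩
  · simp
  have : Nonempty X := ⟨x₀⟩
  have hinj : InjOn f s := by
    intro x hx y hy hxy
    have := hf x hx y hy
    rw [hxy, dist_self, mul_zero] at this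
    exact dist_le_zero.1 this
  have hlip : LipschitzOnWith c (Function.invFunOn f s) (f '' s) := by
    refine LipschitzOnWith.of_dist_le_mul ?_
    rintro _ ⟨x, hx, rfl⟩ _ ⟨y, hy, rfl⟩
    rw [hinj.leftInvOn_invFunOn hx, hinj.leftInvOn_invFunOn hy]
    exact hf x hx y hy
  have h := LipschitzOnWith.euclideanHausdorffMeasure_image_le hlip d
  rwa [hinj.leftInvOn_invFunOn.image_image] at h

/-! ### Parallel lines and spherical measure -/

/-- Fubini's theorem for the decomposition of space into the lines of a given direction. -/
theorem lintegral_eq_lintegral_lines {u : E n} (hu : ‖u‖ = 1) {f : E n → ℝ≥0∞}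
    (hf : Measurable f) :
    ∫⁻ a, f a = ∫⁻ x in ((ℝ ∙ u)ᗮ : Set (E n)), (∫⁻ s : ℝ, f (x + s • u)) ∂(μHE[n - 1]) := by
  have hu0 : u ≠ 0 := by rintro rfl; simp at hu
  have hrank1 : finrank ℝ (ℝ ∙ u) = 1 := finrank_span_singleton hu0
  have hrank : finrank ℝ (ℝ ∙ u)ᗮ = n - 1 := by
    have := (ℝ ∙ u).finrank_add_finrank_orthogonal
    rw [hrank1, finrank_euclideanSpace_fin] at this
    omega
  have hmp := ((ℝ ∙ u).measurePreserving_measurableEquivProd (0 : E n)).symm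
  have hvol : (μHE[finrank ℝ (E n)] : Measure (E n)) = volume :=
    InnerProductSpace.euclideanHausdorffMeasure_eq_volume
  rw [hvol] at hmp
  have hmapv : (volume : Measure (ℝ ∙ u)) =
      (volume : Measure ℝ).map (ContinuousLinearEquiv.toSpanNonzeroSingleton ℝ u hu0) := by
    let v' : (ℝ ∙ u) := ⟨u, Submodule.mem_span_singleton_self u⟩
    have h1 := volume_eq_of_finrank_eq_one hrank1 (v := v') (by simpa [v'] using hu0)
    have h2 : ‖v'‖ₑ = 1 := by simp [v', enorm_eq_nnnorm, ← NNReal.coe_inj, hu]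
    rw [h2, one_smul] at h1
    exact h1
  have hmapw : (volume : Measure (ℝ ∙ u)ᗮ).map Subtype.val =
      (μHE[n - 1] : Measure (E n)).restrict ((ℝ ∙ u)ᗮ : Set (E n)) := by
    rw [← InnerProductSpace.euclideanHausdorffMeasure_eq_volume, hrank,
      isometry_subtype_coe.map_euclideanHausdorffMeasure, Subtype.range_coe]
  rw [← hmp.lintegral_comp hf, Measure.volume_eq_prod, lintegral_prod_symm _ (by fun_prop), ← hmapw,
    MeasurableEmbedding.lintegral_map (MeasurableEmbedding.subtype_coe
      (Submodule.closed_of_finiteDimensional _).measurableSet)]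
  refine lintegral_congr fun y => ?_
  have hemb : MeasurableEmbedding (ContinuousLinearEquiv.toSpanNonzeroSingleton ℝ u hu0) :=
    (ContinuousLinearEquiv.toSpanNonzeroSingleton ℝ u hu0).toHomeomorph.measurableEmbedding
  rw [hmapv, hemb.lintegral_map]
  refine lintegral_congr fun s => ?_
  rw [Submodule.measurableEquivProd_symm_apply]
  simp [add_comm]

theorem measurePreserving_neg_sphereMeasure :
    MeasurePreserving (fun u : S n => -u) (sphereMeasure n) (sphereMeasure n) := by
  refine ⟨continuous_neg.measurable, ?_⟩
  ext s hs
  have hm : Measurable (fun u : S n => -u) := continuous_neg.measurable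
  rw [Measure.map_apply hm hs, sphereMeasure, Measure.toSphere_apply' _ (hm hs),
    Measure.toSphere_apply' _ hs]
  congr 1
  rw [← Measure.measure_preimage_neg]
  congr 1
  ext x
  simp only [mem_preimage, Set.mem_smul]
  constructor
  · rintro ⟨t, ht, _, ⟨u, hu, rfl⟩, h⟩
    exact ⟨t, ht, _, ⟨-u, hu, rfl⟩, by simp [h]⟩
  · rintro ⟨t, ht, _, ⟨u, hu, rfl⟩, h⟩
    exact ⟨t, ht, _, ⟨-u, by simpa using hu, rfl⟩, by simp [h]⟩

/-- Spherical measure is the volume of a cone up to a factor, and the cone over a great subsphere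
lies in a proper subspace. -/
theorem sphereMeasure_orthogonal {v : E n} (hv : v ≠ 0) :
    sphereMeasure n {u : S n | ⟪(u : E n), v⟫ = 0} = 0 := by
  have hm : MeasurableSet {u : S n | ⟪(u : E n), v⟫ = 0} :=
    (isClosed_eq (by fun_prop) continuous_const).measurableSet
  rw [sphereMeasure, Measure.toSphere_apply' _ hm]
  refine mul_eq_zero_of_right _ (measure_mono_null ?_
    (Measure.addHaar_submodule volume (ℝ ∙ v)ᗮ ?_))
  · rintro _ ⟨t, -, _, ⟨u, hu, rfl⟩, rfl⟩
    rw [SetLike.mem_coe, Submodule.mem_orthogonal_singleton_iff_inner_left]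
    simp only [mem_ofPred_eq] at hu
    simp [inner_smul_left, hu]
  · intro h
    have : v ∈ (ℝ ∙ v)ᗮ := h ▸ Submodule.mem_top
    rw [Submodule.mem_orthogonal_singleton_iff_inner_left, inner_self_eq_zero] at this
    exact hv this

/-! ### Cones over flat bases -/

/-- The volume of the cone over a subset of a hyperplane. -/
theorem volume_flatCone (hn : 1 ≤ n) {v : E n} (hv : ‖v‖ = 1) {h : ℝ} (hh : 0 < h)
    {C : Set (E n)} (hC : MeasurableSet C) (hCv : ∀ c ∈ C, ⟪c, v⟫ = h) :
    n * volume {y : E n | ∃ t ∈ Ioc (0 : ℝ) 1, ∃ c ∈ C, y = t • c} =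
      ENNReal.ofReal h * μHE[n - 1] C := by
  have hv0 : v ≠ 0 := by rintro rfl; simp at hv
  -- The height ⟪y, v⟫ recovers the parameter t, so the cone is cut out by measurable conditions on
  -- y.
  have hT : {y : E n | ∃ t ∈ Ioc (0 : ℝ) 1, ∃ c ∈ C, y = t • c} =
      {y : E n | ⟪y, v⟫ ∈ Ioc 0 h} ∩ (fun y : E n => (h / ⟪y, v⟫) • y) ⁻¹' C := by
    ext y
    constructor
    · rintro ⟨t, ht, c, hc, rfl⟩
      simp only [mem_inter_iff, mem_ofPred_eq, inner_smul_left, hCv c hc, mem_preimage,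
        smul_smul, conj_trivial, mem_Ioc]
      refine ⟨⟨by have := ht.1; positivity, by nlinarith [ht.2]⟩, ?_⟩
      rwa [show h / (t * h) * t = 1 by have := ht.1.ne'; field_simp, one_smul]
    · rintro ⟨hy, hyC⟩
      refine ⟨⟪y, v⟫ / h, ⟨div_pos hy.1 hh, (div_le_one hh).2 hy.2⟩, _, hyC, ?_⟩
      simp only [mem_ofPred_eq, mem_Ioc] at hy
      rw [smul_smul, show ⟪y, v⟫ / h * (h / ⟪y, v⟫) = 1 by have := hy.1.ne'; field_simp, one_smul]
  have hTm : MeasurableSet {y : E n | ∃ t ∈ Ioc (0 : ℝ) 1, ∃ c ∈ C, y = t • c} := by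
    rw [hT]
    exact (measurableSet_Ioc.preimage (by fun_prop)).inter (hC.preimage (by fun_prop))
  have key := EuclideanGeometry.euclideanHausdorffMeasure_eq_lintegral (0 : E n) hv0 hTm
  rw [finrank_euclideanSpace_fin, euclideanHausdorffMeasure_eq_volume] at key
  -- The slice at height x is the base scaled by x / h. Integrating (x / h)^(n-1) over (0, h] gives
  -- h / n.
  have hslice : ∀ x : ℝ, μHE[n - 1] ({y : E n | ∃ t ∈ Ioc (0 : ℝ) 1, ∃ c ∈ C, y = t • c} ∩
      AffineSubspace.mk' (x • v +ᵥ (0 : E n)) (ℝ ∙ v)ᗮ) =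
      (Ioc 0 h).indicator (fun x => ENNReal.ofReal ((x / h) ^ (n - 1)) * μHE[n - 1] C) x := by
    intro x
    have hmem : ∀ y : E n, y ∈ AffineSubspace.mk' (x • v +ᵥ (0 : E n)) (ℝ ∙ v)ᗮ ↔ ⟪y, v⟫ = x := by
      intro y
      rw [AffineSubspace.mem_mk', Submodule.mem_orthogonal_singleton_iff_inner_left]
      simp [inner_sub_left, inner_smul_left, hv, sub_eq_zero]
    by_cases hx : x ∈ Ioc 0 h
    · rw [indicator_of_mem hx]
      have hxh : 0 < x / h := div_pos hx.1 hh
      have : {y : E n | ∃ t ∈ Ioc (0 : ℝ) 1, ∃ c ∈ C, y = t • c} ∩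
          AffineSubspace.mk' (x • v +ᵥ (0 : E n)) (ℝ ∙ v)ᗮ = (fun c => (x / h) • c) '' C := by
        ext y
        simp only [mem_inter_iff, SetLike.mem_coe, hmem]
        constructor
        · rintro ⟨⟨t, ht, c, hc, rfl⟩, h2⟩
          refine ⟨c, hc, ?_⟩
          rw [inner_smul_left, hCv c hc] at h2
          simp only [conj_trivial] at h2
          rw [← h2, mul_div_cancel_right₀ _ hh.ne']
        · rintro ⟨c, hc, rfl⟩
          refine ⟨⟨x / h, ⟨hxh, (div_le_one hh).2 hx.2⟩, c, hc, rfl⟩, ?_⟩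
          simp only [inner_smul_left, hCv c hc, conj_trivial]
          field_simp
      rw [this, image_smul, Measure.euclideanHausdorffMeasure_smul₀ _ hxh.ne', ENNReal.smul_def,
        smul_eq_mul]
      congr 1
      rw [← Real.toNNReal_eq_nnnorm_of_nonneg hxh.le, ENNReal.ofReal_pow hxh.le, ENNReal.coe_pow]
      rfl
    · rw [indicator_of_notMem hx]
      convert measure_empty (μ := μHE[n - 1])
      rw [eq_empty_iff_forall_notMem]
      rintro y ⟨⟨t, ht, c, hc, rfl⟩, h2⟩
      rw [SetLike.mem_coe, hmem, inner_smul_left, hCv c hc] at h2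
      simp only [conj_trivial] at h2
      refine hx ⟨?_, ?_⟩
      · rw [← h2]; have := ht.1; positivity
      · rw [← h2]; nlinarith [ht.2]
  simp_rw [hslice] at key
  rw [lintegral_indicator measurableSet_Ioc, lintegral_mul_const _ (by fun_prop),
    enorm_eq_nnnorm, show ‖v‖₊ = 1 from NNReal.eq hv, ENNReal.coe_one, one_mul] at key
  rw [key, ← mul_assoc]
  congr 1
  rw [← ofReal_integral_eq_lintegral_ofReal]
  · rw [← intervalIntegral.integral_of_le hh.le, ← ENNReal.ofReal_natCast, ← ENNReal.ofReal_mul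
      (by positivity)]
    congr 1
    obtain ⟨m, rfl⟩ : ∃ m, n = m + 1 := ⟨n - 1, by omega⟩
    simp only [div_pow, Nat.add_sub_cancel, intervalIntegral.integral_div, integral_pow]
    push_cast
    field_simp
    simp [pow_succ]
  · exact (Continuous.integrableOn_Icc (by fun_prop)).mono_set Ioc_subset_Icc_self
  · filter_upwards [ae_restrict_mem measurableSet_Ioc] with x hx
    have := hx.1
    simp only [Pi.zero_apply]
    positivity

/-! ### Uniform distribution and radial integration -/

/-- The probability integral transform: a function with null level sets, composed with its
distribution function, is uniformly distributed. -/
theorem map_measureReal_sublevel {Ω : Type*} [MeasurableSpace Ω] (μ : Measure Ω)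
    [IsFiniteMeasure μ] {φ : Ω → ℝ} (hφ : Measurable φ) (h0 : ∀ r, μ {ω | φ ω = r} = 0) :
    μ.map (fun ω => μ.real {ω' | φ ω' ≤ φ ω}) = volume.restrict (Ioc 0 (μ.real univ)) := by
  set F : ℝ → ℝ := fun r => μ.real {ω | φ ω ≤ r} with hF
  have hmono : Monotone F := fun a b hab => measureReal_mono fun ω (hω : φ ω ≤ a) => hω.trans hab
  set ν := μ.map φ with hν
  have hνF : ∀ r, ν.real (Iic r) = F r := fun r => by
    rw [hν, map_measureReal_apply hφ measurableSet_Iic]; rfl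
  -- The image measure has no atoms, which makes its distribution function F continuous.
  have : NullSingletonClass ν := ⟨fun r => by
    rw [hν, Measure.map_apply hφ (measurableSet_singleton r)]; exact h0 r⟩
  have hcont : Continuous F := by
    have h1 : Continuous fun b => ∫ _ in (0 : ℝ)..b, (1 : ℝ) ∂ν :=
      intervalIntegral.continuous_primitive
        (fun a b => intervalIntegrable_const) 0
    have h2 : F = fun b => (∫ _ in (0 : ℝ)..b, (1 : ℝ) ∂ν) + F 0 := by
      ext b
      rw [← intervalIntegral.integral_Iic_sub_Iic (integrable_const _).integrableOn
        (integrable_const _).integrableOn]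
      simp [hνF]
    rw [h2]
    fun_prop
  have htop : Tendsto F atTop (𝓝 (μ.real univ)) := by
    have h1 := tendsto_measure_Iic_atTop ν
    have h2 := (ENNReal.tendsto_toReal (measure_ne_top ν univ)).comp h1
    have h3 : (ν univ).toReal = μ.real univ := by
      rw [hν, Measure.map_apply hφ .univ]; rfl
    rw [h3] at h2
    exact h2.congr hνF
  have hbot : Tendsto F atBot (𝓝 0) := by
    have h1 : Tendsto (fun r : ℝ => ν (Iic r)) atBot (𝓝 (ν (⋂ r : ℝ, Iic r))) :=
      tendsto_measure_iInter_atBot (fun i => measurableSet_Iic.nullMeasurableSet)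
        (fun a b hab => Iic_subset_Iic.2 hab) ⟨0, measure_ne_top _ _⟩
    rw [iInter_Iic_eq_empty_iff.2 (by
      rintro ⟨x, hx⟩
      have := hx ⟨x - 1, rfl⟩
      linarith), measure_empty] at h1
    have h2 := (ENNReal.tendsto_toReal ENNReal.zero_ne_top).comp h1
    exact h2.congr hνF
  have hF_le : ∀ r, F r ≤ μ.real univ := fun r => measureReal_mono (subset_univ _)
  have hG : Measurable fun ω => F (φ ω) := hmono.measurable.comp hφ
  -- By continuity F takes the value c. At the largest r with F r ≤ c, the event F ∘ φ ≤ c is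
  -- exactly φ ≤ r, whose measure is F r = c.
  have main : ∀ c, 0 < c → c < μ.real univ → μ.real {ω | F (φ ω) ≤ c} = c := by
    intro c hc0 hc1
    have hne : {r | F r ≤ c}.Nonempty := ((hbot.eventually_lt_const hc0).mono fun _ h => h.le).exists
    have hbdd : BddAbove {r | F r ≤ c} := by
      obtain ⟨M, hM⟩ := (htop.eventually_const_lt hc1).exists
      refine ⟨M, fun r hr => ?_⟩
      by_contra! hlt
      exact absurd (hmono hlt.le) (not_le.2 (lt_of_le_of_lt hr hM))
    set r := sSup {r | F r ≤ c} with hr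
    have hrc : F r ≤ c := (isClosed_le hcont continuous_const).csSup_mem hne hbdd
    have hgt : ∀ r' > r, c < F r' := fun r' hr' => by
      by_contra! hle
      exact absurd (le_csSup hbdd hle) (not_le.2 hr')
    have hcr : c ≤ F r := by
      have h1 : Tendsto F (𝓝[>] r) (𝓝 (F r)) := hcont.continuousAt.tendsto.mono_left inf_le_left
      exact ge_of_tendsto h1 (eventually_mem_nhdsWithin.mono fun r' hr' => (hgt r' hr').le)
    have : {ω | F (φ ω) ≤ c} = {ω | φ ω ≤ r} := by
      ext ω
      exact ⟨fun h => le_csSup hbdd h, fun h => (hmono h).trans hrc⟩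
    rw [this]
    exact le_antisymm hrc hcr
  refine Measure.ext_of_Iic _ _ fun c => ?_
  rw [Measure.map_apply hG measurableSet_Iic, Measure.restrict_apply measurableSet_Iic,
    inter_comm, Ioc_inter_Iic, Real.volume_Ioc, sub_zero]
  change μ {ω | F (φ ω) ≤ c} = _
  rcases le_or_gt (μ.real univ) c with hc | hc
  · rw [min_eq_left hc, show {ω | F (φ ω) ≤ c} = univ from
      eq_univ_of_forall fun ω => (hF_le _).trans hc]
    simp
  rw [min_eq_right hc.le]
  rcases lt_or_ge 0 c with hc0 | hc0
  · rw [← ofReal_measureReal, main c hc0 hc]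
  · rw [ENNReal.ofReal_of_nonpos hc0]
    have h1 : ∀ c' ∈ Ioo 0 (μ.real univ), μ.real {ω | F (φ ω) ≤ c} ≤ c' := fun c' hc' => by
      rw [← main c' hc'.1 hc'.2]
      exact measureReal_mono fun ω (hω : _ ≤ c) => hω.trans (hc0.trans hc'.1.le)
    rcases (measureReal_nonneg (μ := μ) (s := univ)).eq_or_lt with h | h
    · have h2 : μ univ = 0 := by
        rw [measureReal_def] at h
        exact ((ENNReal.toReal_eq_zero_iff _).1 h.symm).resolve_right (measure_ne_top _ _)
      exact measure_mono_null (subset_univ _) h2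
    · have h2 : μ.real {ω | F (φ ω) ≤ c} ≤ 0 :=
        ge_of_tendsto (x := 𝓝[>] (0 : ℝ)) (f := id) (tendsto_id.mono_left inf_le_left)
          (Filter.mem_of_superset (Ioo_mem_nhdsGT h) fun c' hc' => h1 c' hc')
      have h3 : μ.real {ω | F (φ ω) ≤ c} = 0 := le_antisymm h2 measureReal_nonneg
      rw [measureReal_def] at h3
      exact ((ENNReal.toReal_eq_zero_iff _).1 h3).resolve_right (measure_ne_top _ _)

/-- The integral over `(0, L]` of a power. -/
theorem lintegral_Ioc_rpow {p L : ℝ} (hp : -1 < p) (hL : 0 ≤ L) :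
    ∫⁻ t in Ioc 0 L, ENNReal.ofReal (t ^ p) = ENNReal.ofReal (L ^ (p + 1) / (p + 1)) := by
  rw [← ofReal_integral_eq_lintegral_ofReal]
  · rw [← intervalIntegral.integral_of_le hL, integral_rpow (Or.inl hp),
      Real.zero_rpow (by linarith), sub_zero]
  · exact (intervalIntegrable_iff_integrableOn_Ioc_of_le hL).1
      (intervalIntegral.intervalIntegrable_rpow' hp)
  · filter_upwards [ae_restrict_mem measurableSet_Ioc] with x hx
    exact Real.rpow_nonneg hx.1.le _

/-- Integration in polar coordinates. -/
theorem lintegral_eq_lintegral_polar (hn : 1 ≤ n) {f : E n → ℝ≥0∞} (hf : Measurable f) :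
    ∫⁻ a, f a = ∫⁻ u : S n, (∫⁻ r in Ioi (0 : ℝ), ENNReal.ofReal (r ^ (n - 1)) * f (r • (u : E n)))
      ∂(sphereMeasure n) := by
  have : Nontrivial (E n) := by
    have : Nonempty (Fin n) := ⟨⟨0, hn⟩⟩
    infer_instance
  have hmp := (volume : Measure (E n)).measurePreserving_homeomorphUnitSphereProd
  have hne : MeasurableSet ({0}ᶜ : Set (E n)) := (measurableSet_singleton 0).compl
  calc
    ∫⁻ a, f a = ∫⁻ a in ({0}ᶜ : Set (E n)), f a := by rw [restrict_compl_singleton]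
    _ = ∫⁻ a : ({0}ᶜ : Set (E n)), f a ∂(Measure.comap Subtype.val volume) := by
      rw [lintegral_subtype_comap hne]
    _ = ∫⁻ p : S n × Ioi (0 : ℝ), f ((p.2 : ℝ) • (p.1 : E n))
          ∂((sphereMeasure n).prod (Measure.volumeIoiPow (finrank ℝ (E n) - 1))) := by
      rw [sphereMeasure, ← hmp.lintegral_comp (by fun_prop)]
      refine lintegral_congr fun a => ?_
      congr 1
      have h := congrArg Subtype.val ((homeomorphUnitSphereProd (E n)).symm_apply_apply a)
      rw [homeomorphUnitSphereProd_symm_apply_coe] at h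
      exact h.symm
    _ = _ := by
      rw [lintegral_prod _ (by fun_prop)]
      refine lintegral_congr fun u => ?_
      rw [Measure.volumeIoiPow, lintegral_withDensity_eq_lintegral_mul _ (by fun_prop)
        (by fun_prop), finrank_euclideanSpace_fin]
      exact lintegral_subtype_comap measurableSet_Ioi
        (fun r : ℝ => ENNReal.ofReal (r ^ (n - 1)) * f (r • (u : E n)))

/-- Comparison of weighted integrals of a radially constant function over a star body. -/
theorem lintegral_gauge_rpow (hn : 1 ≤ n) {g : E n → ℝ} (hg : Measurable g)
    (hpos : ∀ x, x ≠ 0 → 0 < g x) (hsmul : ∀ t : ℝ, 0 ≤ t → ∀ x, g (t • x) = t * g x)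
    {f : E n → ℝ≥0∞} (hf : Measurable f) (hfs : ∀ t : ℝ, 0 < t → ∀ x, f (t • x) = f x)
    {m : ℝ} (hm : 0 < n + m) :
    ENNReal.ofReal (n + m) * ∫⁻ a in {a | g a ≤ 1}, ENNReal.ofReal (g a ^ m) * f a =
      n * ∫⁻ a in {a | g a ≤ 1}, f a := by
  -- The radial integral of r^(n-1+k) g(u)^k up to 1 / g(u) is g(u)^(-n) / (n + k), so after
  -- multiplication by n + k nothing depends on k. The lemma compares k = m with k = 0.
  have key : ∀ k : ℝ, 0 < n + k →
      ENNReal.ofReal (n + k) * ∫⁻ a in {a | g a ≤ 1}, ENNReal.ofReal (g a ^ k) * f a =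
      ∫⁻ u : S n, ENNReal.ofReal ((g u)⁻¹ ^ n) * f u ∂(sphereMeasure n) := by
    intro k hk
    have hms : MeasurableSet {a | g a ≤ 1} := measurableSet_le hg measurable_const
    have hmf : Measurable fun a => ENNReal.ofReal (g a ^ k) * f a := by fun_prop
    rw [← lintegral_indicator hms, lintegral_eq_lintegral_polar hn (hmf.indicator hms),
      ← lintegral_const_mul]
    · refine lintegral_congr fun u => ?_
      have hgu : 0 < g u := hpos _ (ne_zero_of_mem_unit_sphere u)
      have h1 : ∀ r ∈ Ioi (0 : ℝ), ENNReal.ofReal (r ^ (n - 1)) *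
          {a | g a ≤ 1}.indicator (fun a => ENNReal.ofReal (g a ^ k) * f a) (r • (u : E n)) =
          (Ioc 0 (g u)⁻¹).indicator (fun r => ENNReal.ofReal (r ^ (n + k - 1)) *
            (ENNReal.ofReal (g u ^ k) * f u)) r := by
        intro r (hr : 0 < r)
        have h2 : r • (u : E n) ∈ {a | g a ≤ 1} ↔ r ∈ Ioc 0 (g u)⁻¹ := by
          rw [mem_ofPred_eq, hsmul r hr.le, mem_Ioc, and_iff_right hr, ← one_div,
            le_div_iff₀ hgu]
        by_cases h3 : r ∈ Ioc 0 (g u)⁻¹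
        · rw [indicator_of_mem h3, indicator_of_mem (h2.2 h3), hsmul r hr.le, hfs r hr,
            Real.mul_rpow hr.le hgu.le, ENNReal.ofReal_mul (by positivity), ← mul_assoc,
            ← mul_assoc, ← mul_assoc, ← ENNReal.ofReal_mul (by positivity)]
          congr 3
          rw [← Real.rpow_natCast, ← Real.rpow_add hr, Nat.cast_sub hn]
          congr 1
          push_cast
          ring
        · rw [indicator_of_notMem h3, indicator_of_notMem (mt h2.1 h3), mul_zero]
      rw [setLIntegral_congr_fun measurableSet_Ioi h1, setLIntegral_indicator measurableSet_Ioc,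
        inter_eq_self_of_subset_left Ioc_subset_Ioi_self, lintegral_mul_const _ (by fun_prop),
        lintegral_Ioc_rpow (by linarith) (by positivity), ← mul_assoc, ← mul_assoc,
        ← ENNReal.ofReal_mul hk.le, ← ENNReal.ofReal_mul (mul_nonneg hk.le
          (div_nonneg (by positivity) (by linarith)))]
      congr 2
      rw [sub_add_cancel, mul_div_cancel₀ _ hk.ne', Real.inv_rpow hgu.le, ← Real.rpow_neg hgu.le,
        ← Real.rpow_add hgu, neg_add, neg_add_cancel_right, Real.rpow_neg hgu.le,
        Real.rpow_natCast, inv_pow]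
    · have h4 : Measurable fun p : S n × ℝ => ENNReal.ofReal (p.2 ^ (n - 1)) *
          {a | g a ≤ 1}.indicator (fun a => ENNReal.ofReal (g a ^ k) * f a)
            (p.2 • (p.1 : E n)) := by
        have := hmf.indicator hms
        fun_prop
      exact h4.lintegral_prod_right' (ν := volume.restrict (Ioi (0 : ℝ)))
  rw [key m hm, ← key 0 (by simpa using Nat.pos_of_ne_zero (by omega))]
  simp

/-! ### Support function, normals and the regular boundary -/

/-- The gauge of a convex body with respect to the base point `o`. -/
def gaugeAt (K : ConvexBody (E n)) (o x : E n) : ℝ :=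
  gauge ((fun y => o + y) ⁻¹' (K : Set (E n))) x

/-- The support function of a convex body with respect to the base point `o`. -/
def supportAt (K : ConvexBody (E n)) (o v : E n) : ℝ := supportFn K v - ⟪o, v⟫

/-- The central projection of `o + x` from `o` onto the boundary. -/
def boundaryProj (K : ConvexBody (E n)) (o x : E n) : E n := o + (gaugeAt K o x)⁻¹ • x

section Support

variable (K : ConvexBody (E n))

theorem inner_le_supportFn {y : E n} (hy : y ∈ K) (v : E n) : ⟪y, v⟫ ≤ supportFn K v := by
  rw [real_inner_comm]
  exact le_csSup (K.isCompact.image (by fun_prop : Continuous fun y => ⟪v, y⟫)).bddAbove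
    ⟨y, hy, rfl⟩

theorem inner_sub_le_supportAt {y : E n} (hy : y ∈ K) (o v : E n) :
    ⟪y - o, v⟫ ≤ supportAt K o v := by
  rw [inner_sub_left, supportAt]
  linarith [inner_le_supportFn K hy v]

theorem supportAt_le {o v : E n} {c : ℝ} (h : ∀ y ∈ K, ⟪y - o, v⟫ ≤ c) : supportAt K o v ≤ c := by
  rw [supportAt, sub_le_iff_le_add]
  refine csSup_le (K.nonempty.image _) ?_
  rintro _ ⟨y, hy, rfl⟩
  have := h y hy
  rw [inner_sub_left] at this
  change ⟪v, y⟫ ≤ c + ⟪o, v⟫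
  rw [real_inner_comm]
  linarith

theorem exists_subset_closedBall (o : E n) : ∃ R > 0, ∀ y ∈ K, ‖y - o‖ ≤ R := by
  obtain ⟨R, hR0, hR⟩ := K.isCompact.isBounded.subset_closedBall_lt 0 o
  exact ⟨R, hR0, fun y hy => by simpa [dist_eq_norm] using hR hy⟩

theorem supportAt_sub_le {o : E n} {R : ℝ} (hR : ∀ y ∈ K, ‖y - o‖ ≤ R) (v w : E n) :
    supportAt K o v ≤ supportAt K o w + R * ‖v - w‖ := by
  refine supportAt_le K fun y hy => ?_
  have h1 := inner_sub_le_supportAt K hy o w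
  have h2 : ⟪y - o, v⟫ = ⟪y - o, w⟫ + ⟪y - o, v - w⟫ := by rw [← inner_add_right]; simp
  have h3 := real_inner_le_norm (y - o) (v - w)
  have h4 : ‖y - o‖ * ‖v - w‖ ≤ R * ‖v - w‖ := by
    gcongr
    exact hR y hy
  linarith

theorem continuous_supportFn : Continuous (supportFn K) := by
  obtain ⟨R, hR0, hR⟩ := exists_subset_closedBall K 0
  have : LipschitzWith ⟨R, hR0.le⟩ (supportAt K 0) := LipschitzWith.of_le_add_mul _ fun v w => by
    rw [dist_eq_norm]
    exact supportAt_sub_le K hR v w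
  have h2 : supportAt K 0 = supportFn K := by ext; simp [supportAt]
  rw [← h2]
  exact this.continuous

theorem isNormalAt_iff_supportAt (o z : E n) (v : S n) :
    IsNormalAt K z v ↔ ⟪z - o, (v : E n)⟫ = supportAt K o v := by
  rw [IsNormalAt, inner_sub_left, supportAt, sub_left_inj]

/-- Every boundary point of a convex body with interior points has an outer unit normal. -/
theorem exists_isNormalAt (hK : (interior (K : Set (E n))).Nonempty) {z : E n}
    (hz : z ∈ frontier (K : Set (E n))) : ∃ v : S n, IsNormalAt K z v := by
  have hzK : z ∈ K := K.isClosed.frontier_subset hz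
  obtain ⟨f, hf⟩ := geometric_hahn_banach_open_point K.convex.interior isOpen_interior hz.2
  set w := (InnerProductSpace.toDual ℝ (E n)).symm f with hw
  have hfw : ∀ y, f y = ⟪w, y⟫ := fun y => by simp [hw]
  have hw0 : w ≠ 0 := by
    intro h
    obtain ⟨y, hy⟩ := hK
    have := hf y hy
    simp [hfw, h] at this
  have hle : ∀ y ∈ K, ⟪w, y⟫ ≤ ⟪w, z⟫ := by
    intro y hy
    -- The separating functional only controls the interior; the bound passes to all of `K` because
    -- the interior is dense in it.
    have hcl : y ∈ closure (interior (K : Set (E n))) := by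
      rw [K.convex.closure_interior_eq_closure_of_nonempty_interior hK]
      exact subset_closure hy
    rw [← hfw, ← hfw]
    exact le_on_closure (fun a ha => (hf a ha).le) f.continuous.continuousOn
      continuousOn_const hcl
  have hwn : 0 < ‖w‖ := norm_pos_iff.2 hw0
  refine ⟨⟨‖w‖⁻¹ • w, by simp [norm_smul, hwn.ne']⟩, (isNormalAt_iff K hzK _).2 fun y hy => ?_⟩
  simp only [inner_smul_left, conj_trivial]
  have := hle y hy
  gcongr

/-- Failure of uniqueness means two normals at distance at least 1 / (m + 1) for some m. For fixed m
such triples form a closed set, and projecting away the compact spheres keeps it closed. -/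
theorem measurableSet_regularBoundary (hK : (interior (K : Set (E n))).Nonempty) :
    MeasurableSet (regularBoundary K) := by
  set A : ℕ → Set (E n × S n × S n) := fun m =>
    {p | (∀ y ∈ K, ⟪(p.2.1 : E n), y⟫ ≤ ⟪(p.2.1 : E n), p.1⟫) ∧
      (∀ y ∈ K, ⟪(p.2.2 : E n), y⟫ ≤ ⟪(p.2.2 : E n), p.1⟫) ∧
      1 / ((m : ℝ) + 1) ≤ dist p.2.1 p.2.2} with hA
  have hAcl : ∀ m, IsClosed (A m) := fun m => by
    simp only [hA, ofPred_and, ofPred_forall]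
    refine (isClosed_iInter fun y => isClosed_iInter fun _ => ?_).inter
      ((isClosed_iInter fun y => isClosed_iInter fun _ => ?_).inter ?_)
    · exact isClosed_le (by fun_prop) (by fun_prop)
    · exact isClosed_le (by fun_prop) (by fun_prop)
    · exact isClosed_le (by fun_prop) (by fun_prop)
  have hproj : ∀ m, IsClosed (Prod.fst '' A m) := fun m =>
    isClosedMap_fst_of_compactSpace _ (hAcl m)
  have : regularBoundary K = frontier (K : Set (E n)) \ ⋃ m, Prod.fst '' A m := by
    ext z
    constructor
    · rintro ⟨hz, hv⟩
      have hzK : z ∈ K := K.isClosed.frontier_subset hz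
      refine ⟨hz, ?_⟩
      simp only [mem_iUnion, not_exists]
      rintro m ⟨⟨z, v, w⟩, ⟨h1, h2, h3⟩, rfl⟩
      have hvw : v = w := hv.unique ((isNormalAt_iff K hzK v).2 h1) ((isNormalAt_iff K hzK w).2 h2)
      simp only [hvw, dist_self] at h3
      have : (0 : ℝ) < 1 / ((m : ℝ) + 1) := by positivity
      linarith
    · rintro ⟨hz, hn⟩
      have hzK : z ∈ K := K.isClosed.frontier_subset hz
      obtain ⟨v, hv⟩ := exists_isNormalAt K hK hz
      refine ⟨hz, v, hv, fun w hw => ?_⟩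
      by_contra hne
      obtain ⟨m, hm⟩ := exists_nat_one_div_lt (dist_pos.2 hne)
      exact hn (mem_iUnion.2 ⟨m, (z, w, v), ⟨(isNormalAt_iff K hzK w).1 hw,
        (isNormalAt_iff K hzK v).1 hv, hm.le⟩, rfl⟩)
  rw [this]
  exact isClosed_frontier.measurableSet.diff
    (MeasurableSet.iUnion fun m => (hproj m).measurableSet)

end Support

/-! ### Gauge and central projection -/

section Gauge

variable {K : ConvexBody (E n)} {o : E n}

theorem convex_preimage_add (K : ConvexBody (E n)) (o : E n) :
    Convex ℝ ((fun y => o + y) ⁻¹' (K : Set (E n))) :=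
  K.convex.translate_preimage_right o

theorem preimage_add_mem_nhds (ho : o ∈ interior (K : Set (E n))) :
    (fun y => o + y) ⁻¹' (K : Set (E n)) ∈ 𝓝 (0 : E n) := by
  have : ContinuousAt (fun y => o + y) (0 : E n) := by fun_prop
  exact this.preimage_mem_nhds (by simpa using mem_interior_iff_mem_nhds.1 ho)

theorem exists_ball_subset (ho : o ∈ interior (K : Set (E n))) :
    ∃ r > 0, ∀ x : E n, ‖x‖ ≤ r → o + x ∈ K := by
  obtain ⟨r, hr, h⟩ := Metric.nhds_basis_closedBall.mem_iff.1 (preimage_add_mem_nhds ho)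
  exact ⟨r, hr, fun x hx => h (by simpa using hx)⟩

theorem gaugeAt_nonneg (K : ConvexBody (E n)) (o x : E n) : 0 ≤ gaugeAt K o x := gauge_nonneg _

theorem gaugeAt_smul (K : ConvexBody (E n)) (o : E n) {t : ℝ} (ht : 0 ≤ t) (x : E n) :
    gaugeAt K o (t • x) = t * gaugeAt K o x := gauge_smul_of_nonneg ht x

theorem gaugeAt_zero (K : ConvexBody (E n)) (o : E n) : gaugeAt K o 0 = 0 := gauge_zero

theorem gaugeAt_le_one_iff (ho : o ∈ interior (K : Set (E n))) {x : E n} :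
    gaugeAt K o x ≤ 1 ↔ o + x ∈ K := by
  have hcl : IsClosed ((fun y => o + y) ⁻¹' (K : Set (E n))) :=
    K.isClosed.preimage (by fun_prop)
  rw [gaugeAt, gauge_le_one_iff_mem_closure (convex_preimage_add K o) (preimage_add_mem_nhds ho),
    hcl.closure_eq]
  rfl

theorem gaugeAt_eq_one_iff (ho : o ∈ interior (K : Set (E n))) {x : E n} :
    gaugeAt K o x = 1 ↔ o + x ∈ frontier (K : Set (E n)) := by
  rw [gaugeAt, gauge_eq_one_iff_mem_frontier (convex_preimage_add K o) (preimage_add_mem_nhds ho)]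
  have := (Homeomorph.addLeft o).preimage_frontier (K : Set (E n))
  rw [Homeomorph.coe_addLeft] at this
  rw [← this]
  rfl

theorem gaugeAt_pos (ho : o ∈ interior (K : Set (E n))) {x : E n} (hx : x ≠ 0) :
    0 < gaugeAt K o x := by
  refine (gauge_pos (absorbent_nhds_zero (preimage_add_mem_nhds ho)) ?_).2 hx
  rw [NormedSpace.isVonNBounded_iff ℝ]
  obtain ⟨R, -, hR⟩ := exists_subset_closedBall K o
  refine (isBounded_closedBall (x := (0 : E n)) (r := R)).subset fun x hx => ?_
  simpa using hR _ hx

/-- The explicit constant 1 / r is needed to choose ε in the local comparison of measures. -/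
theorem gaugeAt_sub_le (ho : o ∈ interior (K : Set (E n))) {r : ℝ} (hr : 0 < r)
    (hb : ∀ x : E n, ‖x‖ ≤ r → o + x ∈ K) (a b : E n) :
    gaugeAt K o a - gaugeAt K o b ≤ ‖a - b‖ / r := by
  have h1 : gaugeAt K o a ≤ gaugeAt K o b + gaugeAt K o (a - b) := by
    have := gauge_add_le (convex_preimage_add K o)
      (absorbent_nhds_zero (preimage_add_mem_nhds ho)) b (a - b)
    rwa [add_sub_cancel] at this
  have h2 : r * gaugeAt K o (a - b) ≤ ‖a - b‖ :=
    mul_gauge_le_norm fun x hx => hb x (by simpa using (mem_ball_zero_iff.1 hx).le)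
  rw [mul_comm] at h2
  have := (le_div_iff₀ hr).2 h2
  linarith

theorem exists_lipschitzWith_gaugeAt (ho : o ∈ interior (K : Set (E n))) :
    ∃ c, LipschitzWith c (gaugeAt K o) :=
  (convex_preimage_add K o).lipschitz_gauge (preimage_add_mem_nhds ho)

theorem continuous_gaugeAt (ho : o ∈ interior (K : Set (E n))) : Continuous (gaugeAt K o) :=
  (exists_lipschitzWith_gaugeAt ho).choose_spec.continuous

theorem gaugeAt_boundaryProj_sub (ho : o ∈ interior (K : Set (E n))) {x : E n} (hx : x ≠ 0) :
    gaugeAt K o (boundaryProj K o x - o) = 1 := by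
  have := gaugeAt_pos ho hx
  rw [boundaryProj, add_sub_cancel_left, gaugeAt_smul _ _ (by positivity),
    inv_mul_cancel₀ this.ne']

theorem boundaryProj_mem_frontier (ho : o ∈ interior (K : Set (E n))) {x : E n} (hx : x ≠ 0) :
    boundaryProj K o x ∈ frontier (K : Set (E n)) := by
  have := gaugeAt_boundaryProj_sub ho hx
  rwa [gaugeAt_eq_one_iff ho, add_sub_cancel] at this

theorem boundaryProj_smul (K : ConvexBody (E n)) (o : E n) {t : ℝ} (ht : 0 < t) (x : E n) :
    boundaryProj K o (t • x) = boundaryProj K o x := by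
  rw [boundaryProj, boundaryProj, gaugeAt_smul _ _ ht.le, mul_inv, smul_smul, mul_right_comm,
    inv_mul_cancel₀ ht.ne', one_mul]

theorem boundaryProj_sub_of_mem_frontier (ho : o ∈ interior (K : Set (E n))) {z : E n}
    (hz : z ∈ frontier (K : Set (E n))) : boundaryProj K o (z - o) = z := by
  have : gaugeAt K o (z - o) = 1 := by rwa [gaugeAt_eq_one_iff ho, add_sub_cancel]
  rw [boundaryProj, this]
  simp

theorem measurable_boundaryProj (ho : o ∈ interior (K : Set (E n))) :
    Measurable (boundaryProj K o) := by
  have := (continuous_gaugeAt ho).measurable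
  unfold boundaryProj
  fun_prop

/-- Homogeneous form of the supporting inequality. By `IsNormalAt.inner_eq`, equality holds at x
when v is a normal at the projection of x; every later use of normals rests on this contact. -/
theorem inner_le_gaugeAt_mul (ho : o ∈ interior (K : Set (E n))) (x v : E n) :
    ⟪x, v⟫ ≤ gaugeAt K o x * supportAt K o v := by
  rcases eq_or_ne x 0 with rfl | hx
  · simp [gaugeAt_zero]
  have hg := gaugeAt_pos ho hx
  have h1 := inner_sub_le_supportAt K
    (K.isClosed.frontier_subset (boundaryProj_mem_frontier ho hx)) o v
  rw [boundaryProj, add_sub_cancel_left, inner_smul_left, conj_trivial, ← div_eq_inv_mul,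
    div_le_iff₀ hg] at h1
  linarith

theorem IsNormalAt.inner_eq (ho : o ∈ interior (K : Set (E n))) {x : E n} (hx : x ≠ 0) {v : S n}
    (hv : IsNormalAt K (boundaryProj K o x) v) :
    ⟪x, (v : E n)⟫ = gaugeAt K o x * supportAt K o v := by
  have hg := gaugeAt_pos ho hx
  rw [isNormalAt_iff_supportAt K o, boundaryProj, add_sub_cancel_left, inner_smul_left,
    conj_trivial, ← div_eq_inv_mul, div_eq_iff hg.ne'] at hv
  rw [hv, mul_comm]

theorem le_supportAt {r : ℝ} (hr : 0 < r) (hb : ∀ x : E n, ‖x‖ ≤ r → o + x ∈ K) (v : S n) :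
    r ≤ supportAt K o v := by
  have h1 := inner_sub_le_supportAt K (hb (r • (v : E n)) (by simp [norm_smul, abs_of_pos hr]))
    o v
  simpa [inner_smul_left] using h1

theorem supportAt_pos (ho : o ∈ interior (K : Set (E n))) (v : S n) : 0 < supportAt K o v := by
  obtain ⟨r, hr, hb⟩ := exists_ball_subset ho
  exact hr.trans_le (le_supportAt hr hb v)

/-- Almost every point is projected to a regular boundary point. -/
theorem ae_boundaryProj_mem_regularBoundary (hn : 1 ≤ n) (ho : o ∈ interior (K : Set (E n))) :
    ∀ᵐ x : E n, boundaryProj K o x ∈ regularBoundary K := by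
  have : Nontrivial (E n) := by
    have : Nonempty (Fin n) := ⟨⟨0, hn⟩⟩
    infer_instance
  obtain ⟨c, hc⟩ := exists_lipschitzWith_gaugeAt ho
  have h0 : ∀ᵐ x : E n, x ≠ 0 := by
    simp [ae_iff]
  filter_upwards [hc.ae_differentiableAt (μ := volume), h0] with x hd hx
  have hz := boundaryProj_mem_frontier ho hx
  obtain ⟨v, hv⟩ := exists_isNormalAt K ⟨o, ho⟩ hz
  -- Rademacher's theorem supplies differentiability at x. For a normal w, the nonnegative function
  -- y ↦ g(y) h(w) - ⟪y, w⟫ vanishes at x, so its derivative there is zero.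
  have key : ∀ w : S n, IsNormalAt K (boundaryProj K o x) w →
      (w : E n) = supportAt K o w • gradient (gaugeAt K o) x := by
    intro w hw
    have hmin : IsLocalMin (fun y => gaugeAt K o y * supportAt K o w - ⟪y, (w : E n)⟫) x := by
      refine Eventually.of_forall fun y => ?_
      simp only [hw.inner_eq ho hx, sub_self]
      exact sub_nonneg.2 (inner_le_gaugeAt_mul ho y w)
    have hder : HasFDerivAt (fun y => gaugeAt K o y * supportAt K o w - ⟪y, (w : E n)⟫)
        (supportAt K o w • fderiv ℝ (gaugeAt K o) x - innerSL ℝ (w : E n)) x := by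
      refine (hd.hasFDerivAt.mul_const _).sub ?_
      have := (innerSL ℝ (w : E n)).hasFDerivAt (x := x)
      refine this.congr_of_eventuallyEq (Eventually.of_forall fun y => ?_)
      simp [real_inner_comm]
    have h0 := hmin.hasFDerivAt_eq_zero hder
    rw [sub_eq_zero] at h0
    refine ext_inner_right ℝ fun y => ?_
    have h1 := congrArg (fun f => f y) h0
    simp only [_root_.smul_apply, smul_eq_mul, innerSL_apply_apply] at h1
    rw [← h1, inner_smul_left, conj_trivial, gradient, InnerProductSpace.toDual_symm_apply]
  -- Normalizing removes the factor h(w), which depends on w; the gradient alone then determines the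
  -- normal.
  have key2 : ∀ w : S n, IsNormalAt K (boundaryProj K o x) w →
      (w : E n) = ‖gradient (gaugeAt K o) x‖⁻¹ • gradient (gaugeAt K o) x := by
    intro w hw
    have h1 := key w hw
    have hs := supportAt_pos ho w
    have h2 : ‖(w : E n)‖ = 1 := norm_eq_of_mem_sphere w
    rw [h1, norm_smul, Real.norm_of_nonneg hs.le] at h2
    rw [← eq_inv_of_mul_eq_one_left h2]
    exact h1
  exact ⟨hz, v, hv, fun w hw => Subtype.ext ((key2 w hw).trans (key2 v hv).symm)⟩

end Gauge

/-! ### Cone measure and boundary measure -/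

variable {K : ConvexBody (E n)} {o : E n}

/-- The cone measure: `n` times the image of the volume of the body under central projection. -/
def coneMeasure (K : ConvexBody (E n)) (o : E n) : Measure (E n) :=
  (n : ℝ≥0∞) • (volume.restrict {x | gaugeAt K o x ≤ 1}).map (boundaryProj K o)

/-- The degree-one homogeneous map that flattens the boundary of `K - o` into its supporting
hyperplane with normal `v`. -/
def flatten (K : ConvexBody (E n)) (o v x : E n) : E n :=
  x + (gaugeAt K o x * supportAt K o v - ⟪x, v⟫) • v

theorem continuous_flatten (ho : o ∈ interior (K : Set (E n))) (v : E n) :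
    Continuous (flatten K o v) := by
  have := continuous_gaugeAt ho
  unfold flatten
  fun_prop

theorem flatten_smul {t : ℝ} (ht : 0 ≤ t) (v x : E n) :
    flatten K o v (t • x) = t • flatten K o v x := by
  rw [flatten, flatten, gaugeAt_smul _ _ ht, inner_smul_left, conj_trivial, smul_add, smul_smul]
  congr 2
  ring

theorem inner_flatten (v : S n) (x : E n) :
    ⟪flatten K o v x, (v : E n)⟫ = gaugeAt K o x * supportAt K o v := by
  simp [flatten, inner_add_left, inner_smul_left]

/-- With N in place of v the left side is at most 0, by the supporting inequality with equality at
x. Replacing N by v changes the support function by at most R ε, multiplied by a gauge difference of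
at most ‖x - y‖ / r, and the inner product by at most ε ‖x - y‖. -/
theorem gaugeAt_sub_mul_supportAt_sub_inner_le (ho : o ∈ interior (K : Set (E n))) {r R η ε : ℝ}
    (hr : 0 < r) (hR0 : 0 < R)
    (hb : ∀ x : E n, ‖x‖ ≤ r → o + x ∈ K) (hR : ∀ y ∈ K, ‖y - o‖ ≤ R) (hη : R / r * ε + ε ≤ η)
    {v N : S n} (hN : ‖(N : E n) - v‖ ≤ ε) {x : E n} (hx : x ≠ 0)
    (hNx : IsNormalAt K (boundaryProj K o x) N) (y : E n) :
    (gaugeAt K o x - gaugeAt K o y) * supportAt K o v - ⟪x - y, (v : E n)⟫ ≤ η * ‖x - y‖ := by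
  have h1 := hNx.inner_eq ho hx
  have h2 := inner_le_gaugeAt_mul ho y (N : E n)
  have h3 : |gaugeAt K o x - gaugeAt K o y| ≤ ‖x - y‖ / r :=
    abs_sub_le_iff.2 ⟨gaugeAt_sub_le ho hr hb x y, by
      rw [norm_sub_rev]; exact gaugeAt_sub_le ho hr hb y x⟩
  have h4 : |supportAt K o v - supportAt K o N| ≤ R * ε := by
    refine (abs_sub_le_iff.2 ⟨?_, ?_⟩ : _ ≤ R * ‖(N : E n) - v‖).trans (by gcongr)
    · rw [norm_sub_rev]
      linarith [supportAt_sub_le K hR (v : E n) N]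
    · linarith [supportAt_sub_le K hR (N : E n) v]
  have h5 : ⟪x - y, (N : E n) - v⟫ ≤ ‖x - y‖ * ε :=
    (real_inner_le_norm _ _).trans (by gcongr)
  have h6 : (gaugeAt K o x - gaugeAt K o y) * (supportAt K o v - supportAt K o N) ≤
      ‖x - y‖ / r * (R * ε) := by
    refine (le_abs_self _).trans ?_
    rw [abs_mul]
    gcongr
  have h7 : ‖x - y‖ / r * (R * ε) + ‖x - y‖ * ε ≤ η * ‖x - y‖ := by
    calc _ = (R / r * ε + ε) * ‖x - y‖ := by ring
      _ ≤ _ := by gcongr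
  rw [inner_sub_left, inner_sub_right, inner_sub_right] at h5
  rw [inner_sub_left]
  linarith

/-- Local comparison of volumes of cones with boundary measure: with `C` the flattened set, both
quantities agree up to the factor `c ^ (2 * n)`. -/
theorem coneMeasure_local_comparison (hn : 1 ≤ n) (ho : o ∈ interior (K : Set (E n)))
    {r R η ε : ℝ} (hr : 0 < r) (hR0 : 0 < R) (hε : 0 < ε)
    (hb : ∀ x : E n, ‖x‖ ≤ r → o + x ∈ K) (hR : ∀ y ∈ K, ‖y - o‖ ≤ R) (hη : R / r * ε + ε ≤ η)
    (hη0 : 0 < η) {c : NNReal} (hc : (1 : ℝ) ≤ c * (1 - η)) (v : S n)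
    {W : Set (regularBoundary K)} (hW : MeasurableSet W)
    (hWv : ∀ z ∈ W, ‖(gaussMap K z : E n) - v‖ ≤ ε) :
    coneMeasure K o (Subtype.val '' W) ≤ (c : ℝ≥0∞) ^ (2 * n) *
        ∫⁻ z in W, ENNReal.ofReal (supportAt K o (gaussMap K z)) ∂(μHE[n - 1]) ∧
      ∫⁻ z in W, ENNReal.ofReal (supportAt K o (gaussMap K z)) ∂(μHE[n - 1]) ≤
        (c : ℝ≥0∞) ^ (2 * n) * coneMeasure K o (Subtype.val '' W) := by
  have hX := measurableSet_regularBoundary K ⟨o, ho⟩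
  have hWm : MeasurableSet (Subtype.val '' W : Set (E n)) :=
    (MeasurableEmbedding.subtype_coe hX).measurableSet_image.2 hW
  have hη1 : η < 1 := by
    by_contra! h
    nlinarith [c.coe_nonneg]
  have hc1 : 1 + η ≤ c := by nlinarith
  set Ψ := flatten K o v with hΨ
  set D : Set (E n) := {x | gaugeAt K o x ≤ 1} ∩ boundaryProj K o ⁻¹' (Subtype.val '' W) with hD
  set Z : Set (E n) := (fun z : regularBoundary K => (z : E n) - o) '' W with hZ
  -- At x = 0 the formula for the projection yields o, which is not a boundary point.
  have hPo : ∀ x, boundaryProj K o x ∈ Subtype.val '' W → x ≠ 0 := by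
    rintro x ⟨z, hz, hzx⟩ rfl
    have h1 := z.2.1
    rw [hzx, boundaryProj, smul_zero, add_zero] at h1
    exact h1.2 ho
  have hZP : ∀ x ∈ Z, boundaryProj K o x ∈ Subtype.val '' W := by
    rintro _ ⟨z, hz, rfl⟩
    exact ⟨z, hz, (boundaryProj_sub_of_mem_frontier ho z.2.1).symm⟩
  have hZg : ∀ x ∈ Z, gaugeAt K o x = 1 := by
    rintro _ ⟨z, hz, rfl⟩
    rw [gaugeAt_eq_one_iff ho, add_sub_cancel]
    exact z.2.1
  -- Flattening moves points only along v. The one-sided estimate at x and at y together bounds the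
  -- difference of the displacements, so flattening is a perturbation of the identity with Lipschitz
  -- constant η.
  have hdisp : ∀ x y, boundaryProj K o x ∈ Subtype.val '' W →
      boundaryProj K o y ∈ Subtype.val '' W → ‖(Ψ x - Ψ y) - (x - y)‖ ≤ η * ‖x - y‖ := by
    intro x y hx hy
    have hx0 := hPo x hx
    have hy0 := hPo y hy
    obtain ⟨z, hz, hzx⟩ := hx
    obtain ⟨w, hw, hwy⟩ := hy
    have h1 := gaugeAt_sub_mul_supportAt_sub_inner_le ho hr hR0 hb hR hη (hWv z hz) hx0
      (hzx ▸ gaussMap_spec K z) y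
    have h2 := gaugeAt_sub_mul_supportAt_sub_inner_le ho hr hR0 hb hR hη (hWv w hw) hy0
      (hwy ▸ gaussMap_spec K w) x
    have h3 : (Ψ x - Ψ y) - (x - y) = ((gaugeAt K o x - gaugeAt K o y) * supportAt K o v -
        ⟪x - y, (v : E n)⟫) • (v : E n) := by
      rw [hΨ, flatten, flatten, inner_sub_left]
      module
    rw [h3, norm_smul, norm_eq_of_mem_sphere, mul_one, Real.norm_eq_abs, abs_le]
    refine ⟨?_, h1⟩
    rw [norm_sub_rev, ← neg_sub x y, inner_neg_left] at h2
    linarith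
  have hlip : ∀ x y, boundaryProj K o x ∈ Subtype.val '' W →
      boundaryProj K o y ∈ Subtype.val '' W → dist (Ψ x) (Ψ y) ≤ c * dist x y := by
    intro x y hx hy
    rw [dist_eq_norm, dist_eq_norm]
    have h1 := hdisp x y hx hy
    have h2 := norm_le_norm_add_norm_sub' (Ψ x - Ψ y) (x - y)
    nlinarith [norm_nonneg (x - y)]
  have hanti : ∀ x y, boundaryProj K o x ∈ Subtype.val '' W →
      boundaryProj K o y ∈ Subtype.val '' W → dist x y ≤ c * dist (Ψ x) (Ψ y) := by
    intro x y hx hy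
    rw [dist_eq_norm, dist_eq_norm]
    have h1 := hdisp x y hx hy
    have h2 := norm_le_norm_add_norm_sub (Ψ x - Ψ y) (x - y)
    have h3 : (1 - η) * ‖x - y‖ ≤ ‖Ψ x - Ψ y‖ := by linarith
    calc ‖x - y‖ ≤ c * (1 - η) * ‖x - y‖ := le_mul_of_one_le_left (norm_nonneg _) hc
      _ = c * ((1 - η) * ‖x - y‖) := by ring
      _ ≤ _ := by gcongr
  have hZm : MeasurableSet Z := by
    have : Z = (fun z : E n => z - o) '' (Subtype.val '' W) := by rw [image_image]
    rw [this]
    exact (Homeomorph.subRight o).measurableEmbedding.measurableSet_image.2 hWm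
  have hCm : MeasurableSet (Ψ '' Z) := by
    refine hZm.image_of_continuousOn_injOn (continuous_flatten ho _).continuousOn ?_
    intro x hx y hy hxy
    have := hanti x y (hZP x hx) (hZP y hy)
    rw [hxy, dist_self, mul_zero] at this
    exact dist_le_zero.1 this
  -- Flattening is homogeneous, so it carries the cone over the boundary piece to the cone over the
  -- flattened piece, which lies in a hyperplane at height `supportAt K o v`.
  have hDflat : Ψ '' D = {y : E n | ∃ t ∈ Ioc (0 : ℝ) 1, ∃ p ∈ Ψ '' Z, y = t • p} := by
    ext y
    constructor
    · rintro ⟨x, ⟨hx1, hx2⟩, rfl⟩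
      have hg := gaugeAt_pos ho (hPo x hx2)
      obtain ⟨z, hz, hzx⟩ := hx2
      refine ⟨gaugeAt K o x, ⟨hg, hx1⟩, Ψ (z - o), ⟨_, ⟨z, hz, rfl⟩, rfl⟩, ?_⟩
      rw [hΨ, ← flatten_smul hg.le, hzx, boundaryProj, add_sub_cancel_left, smul_inv_smul₀ hg.ne']
    · rintro ⟨t, ht, _, ⟨x, hx, rfl⟩, rfl⟩
      refine ⟨t • x, ⟨?_, ?_⟩, flatten_smul ht.1.le _ _⟩
      · rw [mem_ofPred_eq, gaugeAt_smul _ _ ht.1.le, hZg x hx, mul_one]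
        exact ht.2
      · rw [mem_preimage, boundaryProj_smul _ _ ht.1]
        exact hZP x hx
  have hflat : n * volume (Ψ '' D) = ENNReal.ofReal (supportAt K o v) * μHE[n - 1] (Ψ '' Z) := by
    rw [hDflat]
    refine volume_flatCone hn (norm_eq_of_mem_sphere v) (supportAt_pos ho v) hCm ?_
    rintro _ ⟨x, hx, rfl⟩
    rw [hΨ, inner_flatten, hZg x hx, one_mul]
  have hcone : coneMeasure K o (Subtype.val '' W) = n * volume D := by
    have hgm : MeasurableSet {x | gaugeAt K o x ≤ 1} :=
      (isClosed_le (continuous_gaugeAt ho) continuous_const).measurableSet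
    rw [coneMeasure, Measure.smul_apply, Measure.map_apply (measurable_boundaryProj ho) hWm,
      Measure.restrict_apply (measurable_boundaryProj ho hWm), inter_comm, smul_eq_mul]
  have hHZ : μHE[n - 1] Z = μHE[n - 1] W := by
    have : Isometry fun z : regularBoundary K => (z : E n) - o :=
      (IsometryEquiv.subRight o).isometry.comp isometry_subtype_coe
    exact this.euclideanHausdorffMeasure_image W
  have hvol1 : volume (Ψ '' D) ≤ (c : ℝ≥0∞) ^ n * volume D := by
    rw [← euclideanHausdorffMeasure_eq_volume]
    exact LipschitzOnWith.euclideanHausdorffMeasure_image_le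
      (LipschitzOnWith.of_dist_le_mul fun x hx y hy => hlip x y hx.2 hy.2) n
  have hvol2 : volume D ≤ (c : ℝ≥0∞) ^ n * volume (Ψ '' D) := by
    rw [← euclideanHausdorffMeasure_eq_volume]
    exact euclideanHausdorffMeasure_le_image_of_dist_le
      (fun x hx y hy => hanti x y hx.2 hy.2) n
  have hH1 : μHE[n - 1] (Ψ '' Z) ≤ (c : ℝ≥0∞) ^ (n - 1) * μHE[n - 1] W := by
    rw [← hHZ]
    exact LipschitzOnWith.euclideanHausdorffMeasure_image_le
      (LipschitzOnWith.of_dist_le_mul fun x hx y hy => hlip x y (hZP x hx) (hZP y hy)) _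
  have hH2 : μHE[n - 1] W ≤ (c : ℝ≥0∞) ^ (n - 1) * μHE[n - 1] (Ψ '' Z) := by
    rw [← hHZ]
    exact euclideanHausdorffMeasure_le_image_of_dist_le
      (fun x hx y hy => hanti x y (hZP x hx) (hZP y hy)) _
  -- Since the support function is at least r, an absolute change of R ε is a relative change of at
  -- most η.
  have hRε : R * ε ≤ η * r := by
    have : R / r * ε ≤ η := by linarith
    rw [div_mul_eq_mul_div, div_le_iff₀ hr] at this
    exact this
  have hsup1 : ∀ z ∈ W, supportAt K o v ≤ c * supportAt K o (gaussMap K z) := by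
    intro z hz
    have h1 := supportAt_sub_le K hR (v : E n) (gaussMap K z)
    have h2 := le_supportAt hr hb (gaussMap K z)
    have h3 : R * ‖(v : E n) - gaussMap K z‖ ≤ R * ε := by
      rw [norm_sub_rev]; gcongr; exact hWv z hz
    nlinarith
  have hsup2 : ∀ z ∈ W, supportAt K o (gaussMap K z) ≤ c * supportAt K o v := by
    intro z hz
    have h1 := supportAt_sub_le K hR (gaussMap K z : E n) v
    have h2 := le_supportAt hr hb v
    have h3 : R * ‖(gaussMap K z : E n) - v‖ ≤ R * ε := by
      gcongr; exact hWv z hz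
    nlinarith
  have hI1 : ENNReal.ofReal (supportAt K o v) * μHE[n - 1] W ≤
      c * ∫⁻ z in W, ENNReal.ofReal (supportAt K o (gaussMap K z)) ∂(μHE[n - 1]) := by
    rw [← setLIntegral_const, ← lintegral_const_mul' _ _ ENNReal.coe_ne_top]
    refine setLIntegral_mono' hW fun z hz => ?_
    rw [← ENNReal.ofReal_coe_nnreal, ← ENNReal.ofReal_mul c.coe_nonneg]
    exact ENNReal.ofReal_le_ofReal (hsup1 z hz)
  have hI2 : ∫⁻ z in W, ENNReal.ofReal (supportAt K o (gaussMap K z)) ∂(μHE[n - 1]) ≤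
      c * (ENNReal.ofReal (supportAt K o v) * μHE[n - 1] W) := by
    rw [← setLIntegral_const, ← lintegral_const_mul' _ _ ENNReal.coe_ne_top]
    refine setLIntegral_mono' hW fun z hz => ?_
    rw [← ENNReal.ofReal_coe_nnreal, ← ENNReal.ofReal_mul c.coe_nonneg]
    exact ENNReal.ofReal_le_ofReal (hsup2 z hz)
  -- One factor c^n comes from the volume of the cone, c^(n-1) from the area of the base, and c from
  -- the oscillation of the support function.
  have hpow : (c : ℝ≥0∞) ^ (2 * n) = (c : ℝ≥0∞) ^ n * ((c : ℝ≥0∞) ^ (n - 1) * c) := by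
    rw [← pow_succ, Nat.sub_add_cancel hn, ← pow_add, two_mul]
  rw [hcone, hpow]
  constructor
  · calc (n : ℝ≥0∞) * volume D ≤ n * ((c : ℝ≥0∞) ^ n * volume (Ψ '' D)) := by gcongr
      _ = (c : ℝ≥0∞) ^ n * (n * volume (Ψ '' D)) := by ring
      _ = (c : ℝ≥0∞) ^ n * (ENNReal.ofReal (supportAt K o v) * μHE[n - 1] (Ψ '' Z)) := by rw [hflat]
      _ ≤ (c : ℝ≥0∞) ^ n * (ENNReal.ofReal (supportAt K o v) *
          ((c : ℝ≥0∞) ^ (n - 1) * μHE[n - 1] W)) := by gcongr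
      _ = (c : ℝ≥0∞) ^ n * ((c : ℝ≥0∞) ^ (n - 1) *
          (ENNReal.ofReal (supportAt K o v) * μHE[n - 1] W)) := by ring
      _ ≤ (c : ℝ≥0∞) ^ n * ((c : ℝ≥0∞) ^ (n - 1) * (c *
          ∫⁻ z in W, ENNReal.ofReal (supportAt K o (gaussMap K z)) ∂(μHE[n - 1]))) := by gcongr
      _ = _ := by ring
  · calc _ ≤ c * (ENNReal.ofReal (supportAt K o v) * μHE[n - 1] W) := hI2
      _ ≤ c * (ENNReal.ofReal (supportAt K o v) *
          ((c : ℝ≥0∞) ^ (n - 1) * μHE[n - 1] (Ψ '' Z))) := by gcongr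
      _ = c * (c : ℝ≥0∞) ^ (n - 1) * (n * volume (Ψ '' D)) := by rw [hflat]; ring
      _ ≤ c * (c : ℝ≥0∞) ^ (n - 1) * (n * ((c : ℝ≥0∞) ^ n * volume D)) := by gcongr
      _ = _ := by ring

/-- Two measures that are comparable, with constants arbitrarily close to `1`, on sets with
small image under a map to a separable space, are ordered. -/
theorem measure_le_of_local_comparison {X Y : Type*} [MeasurableSpace X] [PseudoMetricSpace Y]
    [TopologicalSpace.SeparableSpace Y] [Nonempty Y] [MeasurableSpace Y] [BorelSpace Y]
    {μ ν : Measure X} {f : X → Y} (hf : Measurable f) (k : ℕ)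
    (h : ∀ c : NNReal, 1 < c → ∃ ε > 0, ∀ y : Y, ∀ W : Set X, MeasurableSet W →
      (∀ x ∈ W, dist (f x) y ≤ ε) → μ W ≤ (c : ℝ≥0∞) ^ k * ν W) : μ ≤ ν := by
  refine Measure.le_iff.2 fun W hW => ?_
  have hc : ∀ c : NNReal, 1 < c → μ W ≤ (c : ℝ≥0∞) ^ k * ν W := by
    intro c hc
    obtain ⟨ε, hε, hloc⟩ := h c hc
    -- Balls of radius ε around a dense sequence, made disjoint, cut `W` into countably many pieces
    -- with small image.
    set T : ℕ → Set X := fun i => f ⁻¹' ball (TopologicalSpace.denseSeq Y i) ε with hT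
    have hTm : ∀ i, MeasurableSet (T i) := fun i => hf measurableSet_ball
    have hcov : ⋃ i, disjointed T i = univ := by
      rw [iUnion_disjointed]
      refine eq_univ_of_forall fun x => mem_iUnion.2 ?_
      obtain ⟨y, hy, ⟨i, rfl⟩⟩ :=
        Metric.dense_iff.1 (TopologicalSpace.denseRange_denseSeq Y) (f x) ε hε
      exact ⟨i, by rw [hT, mem_preimage, mem_ball']; exact hy⟩
    have hsplit : ∀ ρ : Measure X, ρ W = ∑' i, ρ (W ∩ disjointed T i) := by
      intro ρ
      rw [← measure_iUnion, ← inter_iUnion, hcov, inter_univ]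
      · intro i j hij
        exact (disjoint_disjointed T hij).mono inter_subset_right inter_subset_right
      · exact fun i => hW.inter (MeasurableSet.disjointed hTm i)
    rw [hsplit μ, hsplit ν, ← ENNReal.tsum_mul_left]
    refine ENNReal.tsum_le_tsum fun i => hloc (TopologicalSpace.denseSeq Y i) _
      (hW.inter (MeasurableSet.disjointed hTm i)) ?_
    intro x hx
    exact (mem_ball.1 (disjointed_subset T i hx.2)).le
  -- Let c decrease to 1. The limit of c^k is nonzero, so ν W = ∞ causes no trouble.
  have hlim : Tendsto (fun c : NNReal => (c : ℝ≥0∞) ^ k * ν W) (𝓝[>] 1)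
      (𝓝 (((1 : NNReal) : ℝ≥0∞) ^ k * ν W)) := by
    refine ENNReal.Tendsto.mul_const ?_ (Or.inl (by simp))
    have : Continuous fun c : NNReal => (c : ℝ≥0∞) ^ k := by
      simp_rw [← ENNReal.coe_pow]
      exact ENNReal.continuous_coe.comp (continuous_pow k)
    exact this.continuousAt.tendsto.mono_left inf_le_left
  have := ge_of_tendsto hlim (eventually_mem_nhdsWithin.mono fun c h => hc c h)
  simpa using this

/-- Where the Gauss map is nearly constant, flattening compares both measures with the same flat
cone. Gluing such pieces gives both inequalities. -/
theorem withDensity_supportAt_eq_comap_coneMeasure (hn : 1 ≤ n)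
    (ho : o ∈ interior (K : Set (E n))) :
    (μHE[n - 1] : Measure (regularBoundary K)).withDensity
      (fun z => ENNReal.ofReal (supportAt K o (gaussMap K z))) =
    (coneMeasure K o).comap Subtype.val := by
  have hX := measurableSet_regularBoundary K ⟨o, ho⟩
  obtain ⟨r, hr, hb⟩ := exists_ball_subset ho
  obtain ⟨R, hR0, hR⟩ := exists_subset_closedBall K o
  have : Nonempty (S n) := by
    have : Nonempty (Fin n) := ⟨⟨0, hn⟩⟩
    have : Nontrivial (E n) := inferInstance
    exact (NormedSpace.sphere_nonempty (x := (0 : E n)) (r := 1)).2 zero_le_one |>.to_subtype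
  have key : ∀ c : NNReal, 1 < c → ∃ ε > 0, ∀ v : S n, ∀ W : Set (regularBoundary K),
      MeasurableSet W → (∀ z ∈ W, dist (gaussMap K z) v ≤ ε) →
      coneMeasure K o (Subtype.val '' W) ≤ (c : ℝ≥0∞) ^ (2 * n) *
        ∫⁻ z in W, ENNReal.ofReal (supportAt K o (gaussMap K z)) ∂(μHE[n - 1]) ∧
      ∫⁻ z in W, ENNReal.ofReal (supportAt K o (gaussMap K z)) ∂(μHE[n - 1]) ≤
        (c : ℝ≥0∞) ^ (2 * n) * coneMeasure K o (Subtype.val '' W) :=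
    fun c hc => by
      have hc' : (1 : ℝ) < c := by exact_mod_cast hc
      -- This η makes c (1 - η) = 1, and the ε below solves (R / r) ε + ε = η.
      set η : ℝ := 1 - (c : ℝ)⁻¹ with hη
      have hη0 : 0 < η := sub_pos.2 (inv_lt_one_of_one_lt₀ hc')
      have hden : 0 < R / r + 1 := by positivity
      refine ⟨η / (R / r + 1), by positivity, fun v W hW hWv =>
        coneMeasure_local_comparison hn ho hr hR0 (ε := η / (R / r + 1)) (η := η) (c := c)
          (by positivity) hb hR (le_of_eq ?_) hη0 (le_of_eq ?_) v hW ?_⟩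
      · field_simp
      · rw [hη, sub_sub_cancel, mul_inv_cancel₀ (by positivity)]
      · intro z hz
        simpa [Subtype.dist_eq, dist_eq_norm] using hWv z hz
  have hm := (continuous_gaussMap K).measurable
  refine le_antisymm ?_ ?_
  · refine measure_le_of_local_comparison hm (2 * n) fun c hc => ?_
    obtain ⟨ε, hε, h⟩ := key c hc
    refine ⟨ε, hε, fun v W hW hWv => ?_⟩
    rw [withDensity_apply _ hW, (MeasurableEmbedding.subtype_coe hX).comap_apply]
    exact (h v W hW hWv).2
  · refine measure_le_of_local_comparison hm (2 * n) fun c hc => ?_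
    obtain ⟨ε, hε, h⟩ := key c hc
    refine ⟨ε, hε, fun v W hW hWv => ?_⟩
    rw [withDensity_apply _ hW, (MeasurableEmbedding.subtype_coe hX).comap_apply]
    exact (h v W hW hWv).1

/-- Integration over the regular boundary against `(z - o) ⬝ ν` in terms of the volume. -/
theorem lintegral_regularBoundary_supportAt (hn : 1 ≤ n) (ho : o ∈ interior (K : Set (E n)))
    {f : E n → ℝ≥0∞} (hf : Measurable f) :
    ∫⁻ z : regularBoundary K, ENNReal.ofReal (supportAt K o (gaussMap K z)) * f z ∂(μHE[n - 1]) =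
      n * ∫⁻ x in {x | gaugeAt K o x ≤ 1}, f (boundaryProj K o x) := by
  have hX := measurableSet_regularBoundary K ⟨o, ho⟩
  have hP := measurable_boundaryProj ho
  have hd : Measurable fun z : regularBoundary K =>
      ENNReal.ofReal (supportAt K o (gaussMap K z)) := by
    have h1 := (continuous_supportFn K).measurable
    have h2 := (continuous_gaussMap K).measurable
    unfold supportAt
    fun_prop
  have h1 := lintegral_withDensity_eq_lintegral_mul (μHE[n - 1] : Measure (regularBoundary K)) hd
    (g := fun z => f z) (by fun_prop)
  simp only [Pi.mul_apply] at h1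
  rw [← h1, withDensity_supportAt_eq_comap_coneMeasure hn ho, lintegral_subtype_comap hX,
    coneMeasure, Measure.restrict_smul, lintegral_smul_measure, smul_eq_mul,
    Measure.restrict_eq_self_of_ae_mem, lintegral_map hf hP]
  -- The cone measure charges only the regular boundary, so restricting to it loses nothing.
  refine (ae_map_iff hP.aemeasurable hX).2 ?_
  exact ae_restrict_of_ae (ae_boundaryProj_mem_regularBoundary hn ho)

/-! ### Radial function and dual quermassintegral -/

section Radial

theorem isCompact_chord (K : ConvexBody (E n)) (z : E n) {u : E n} (hu : ‖u‖ = 1) :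
    IsCompact {t : ℝ | z + t • u ∈ K} := by
  obtain ⟨R, -, hR⟩ := exists_subset_closedBall K z
  refine Metric.isCompact_of_isClosed_isBounded (K.isClosed.preimage (by fun_prop)) ?_
  refine (isBounded_closedBall (x := (0 : ℝ)) (r := R)).subset fun t ht => ?_
  have := hR _ ht
  rwa [add_sub_cancel_left, norm_smul, hu, mul_one, ← mem_closedBall_zero_iff] at this

theorem convex_chord (K : ConvexBody (E n)) (z u : E n) : Convex ℝ {t : ℝ | z + t • u ∈ K} := by
  intro s hs t ht a b ha hb hab
  have := K.convex hs ht ha hb hab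
  rw [mem_ofPred_eq]
  convert! this using 1
  obtain rfl : b = 1 - a := by linarith
  simp only [smul_eq_mul]
  module

theorem radialFn_nonneg {z : E n} (hz : z ∈ K) {u : E n} (hu : ‖u‖ = 1) : 0 ≤ radialFn K z u :=
  le_csSup (isCompact_chord K z hu).bddAbove (by simpa using hz)

/-- A line through a point of `K` meets `K` in the segment determined by the radial function. -/
theorem chord_eq_Icc {z : E n} (hz : z ∈ K) {u : E n} (hu : ‖u‖ = 1) :
    {t : ℝ | z + t • u ∈ K} = Icc (-radialFn K z (-u)) (radialFn K z u) := by
  have h0 : (0 : ℝ) ∈ {t : ℝ | z + t • u ∈ K} := by simpa using hz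
  have hc := isCompact_chord K z hu
  have hneg : {t : ℝ | z + t • (-u) ∈ K} = -{t : ℝ | z + t • u ∈ K} := by
    ext t; simp
  have hinf : -radialFn K z (-u) = sInf {t : ℝ | z + t • u ∈ K} := by
    rw [radialFn, hneg, Real.sInf_def]
  refine Subset.antisymm (fun t ht => ⟨?_, le_csSup hc.bddAbove ht⟩) ?_
  · rw [hinf]
    exact csInf_le hc.bddBelow ht
  · rw [hinf]
    exact (convex_chord K z u).ordConnected.out (hc.sInf_mem ⟨0, h0⟩) (hc.sSup_mem ⟨0, h0⟩)

theorem le_radialFn_iff {z : E n} (hz : z ∈ K) {u : E n} (hu : ‖u‖ = 1) {c : ℝ} (hc : 0 ≤ c) :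
    c ≤ radialFn K z u ↔ z + c • u ∈ K := by
  have h1 := radialFn_nonneg hz (u := -u) (by simpa using hu)
  have h2 := Set.ext_iff.1 (chord_eq_Icc hz hu) c
  exact (h2.trans ⟨fun h => h.2, fun h => ⟨by linarith, h⟩⟩).symm

-- With the value 0 outside `K`, the superlevel set at c > 0 is the closed set where both z and z +
-- c u lie in `K`.
open Classical in
theorem measurable_radialFn (K : ConvexBody (E n)) :
    Measurable fun p : E n × S n => if p.1 ∈ K then radialFn K p.1 p.2 else 0 := by
  refine measurable_of_Ici fun c => ?_
  rcases le_or_gt c 0 with hc | hc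
  · convert MeasurableSet.univ
    refine eq_univ_of_forall fun p => ?_
    rw [mem_preimage, mem_Ici]
    split_ifs with h
    · exact hc.trans (radialFn_nonneg h (norm_eq_of_mem_sphere p.2))
    · exact hc
  · have : (fun p : E n × S n => if p.1 ∈ K then radialFn K p.1 p.2 else 0) ⁻¹' Ici c =
        (fun p : E n × S n => p.1) ⁻¹' K ∩ (fun p : E n × S n => p.1 + c • (p.2 : E n)) ⁻¹' K := by
      ext p
      rw [mem_preimage, mem_Ici]
      split_ifs with h
      · rw [le_radialFn_iff h (norm_eq_of_mem_sphere p.2) hc.le]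
        exact ⟨fun h2 => ⟨h, h2⟩, fun h2 => h2.2⟩
      · exact ⟨fun h2 => absurd h2 (not_le.2 hc), fun h2 => absurd h2.1 h⟩
    rw [this]
    exact (K.isClosed.measurableSet.preimage (by fun_prop)).inter
      (K.isClosed.measurableSet.preimage (by fun_prop))

/-- The function `t ↦ t ^ p` on positive numbers, extended by `0`. -/
def posPow (p t : ℝ) : ℝ≥0∞ := (Ioi (0 : ℝ)).indicator (fun t => ENNReal.ofReal (t ^ p)) t

theorem measurable_posPow (p : ℝ) : Measurable (posPow p) :=
  Measurable.indicator (by fun_prop) measurableSet_Ioi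

theorem posPow_of_pos (p : ℝ) {t : ℝ} (ht : 0 < t) : posPow p t = ENNReal.ofReal (t ^ p) :=
  indicator_of_mem ht _

theorem posPow_of_nonpos (p : ℝ) {t : ℝ} (ht : t ≤ 0) : posPow p t = 0 :=
  indicator_of_notMem (not_lt.2 ht) _

theorem posPow_mul (p : ℝ) {s t : ℝ} (hs : 0 < s) :
    posPow p (s * t) = ENNReal.ofReal (s ^ p) * posPow p t := by
  rcases le_or_gt t 0 with ht | ht
  · rw [posPow_of_nonpos p ht, posPow_of_nonpos p (by nlinarith), mul_zero]
  · rw [posPow_of_pos p ht, posPow_of_pos p (by positivity), Real.mul_rpow hs.le ht.le,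
      ENNReal.ofReal_mul (by positivity)]

/-- The power is additive only because one summand vanishes. This needs the value 0 at 0 even for p
= 0, where `Real.rpow` would give 1. -/
theorem posPow_add (p : ℝ) {s t : ℝ} (hs : 0 ≤ s) (ht : 0 ≤ t) (h : s = 0 ∨ t = 0) :
    posPow p s + posPow p t = posPow p (s + t) := by
  rcases h with rfl | rfl <;> simp [posPow_of_nonpos p le_rfl]

open Classical in
/-- The dual quermassintegral as an integral over the whole sphere, extended by `0` outside `K`. -/
def dualQuermassExt (p : ℝ) (K : ConvexBody (E n)) (z : E n) : ℝ≥0∞ :=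
  (n : ℝ≥0∞)⁻¹ * ∫⁻ u : S n, posPow p (if z ∈ K then radialFn K z u else 0) ∂(sphereMeasure n)

instance : IsFiniteMeasure (sphereMeasure n) := by
  unfold sphereMeasure
  infer_instance

theorem measurable_dualQuermassExt (p : ℝ) (K : ConvexBody (E n)) :
    Measurable (dualQuermassExt p K) := by
  classical
  have h1 : Measurable fun x : E n × S n =>
      posPow p (if x.1 ∈ K then radialFn K x.1 x.2 else 0) :=
    (measurable_posPow p).comp (measurable_radialFn K)
  exact (h1.lintegral_prod_right' (ν := sphereMeasure n)).const_mul _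

theorem dualQuermassExt_eq_of_mem (p : ℝ) {z : E n} (hz : z ∈ K) :
    dualQuermassExt p K z =
      (n : ℝ≥0∞)⁻¹ * ∫⁻ u : S n, posPow p (radialFn K z u) ∂(sphereMeasure n) := by
  simp [dualQuermassExt, hz]

theorem measurable_radialFn_of_mem {z : E n} (hz : z ∈ K) :
    Measurable fun u : S n => radialFn K z u := by
  have := (measurable_radialFn K).comp (measurable_prodMk_left (x := z))
  simpa [Function.comp_def, hz] using this

theorem dualQuermass_eq_dualQuermassExt (p : ℝ) {z : E n} (hz : z ∈ K) :
    dualQuermass p K z = dualQuermassExt p K z := by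
  rw [dualQuermassExt_eq_of_mem p hz, dualQuermass, ← lintegral_indicator
    (measurableSet_lt measurable_const (measurable_radialFn_of_mem hz))]
  rfl

end Radial

/-! ### Chords of the dilates -/

section Sublevel

/-- The length of the chord, in direction `u`, of the sublevel set of the gauge through `x`. -/
def sublevelChord (K : ConvexBody (E n)) (o x u : E n) : ℝ :=
  volume.real {t : ℝ | gaugeAt K o (x + t • u) ≤ gaugeAt K o x}

/-- Scaling by 1 / g(x) carries the sublevel set through x to `K - o` and x to its projection, where
the chord is known from the radial function. -/
theorem sublevel_eq_Icc (ho : o ∈ interior (K : Set (E n))) {x : E n} (hx : x ≠ 0) {u : E n}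
    (hu : ‖u‖ = 1) :
    {t : ℝ | gaugeAt K o (x + t • u) ≤ gaugeAt K o x} =
      Icc (-(gaugeAt K o x * radialFn K (boundaryProj K o x) (-u)))
        (gaugeAt K o x * radialFn K (boundaryProj K o x) u) := by
  have hg := gaugeAt_pos ho hx
  have hz := K.isClosed.frontier_subset (boundaryProj_mem_frontier ho hx)
  have hI := chord_eq_Icc hz hu
  ext t
  have h1 := Set.ext_iff.1 hI (t / gaugeAt K o x)
  have h2 : gaugeAt K o (x + t • u) ≤ gaugeAt K o x ↔
      t / gaugeAt K o x ∈ {t : ℝ | boundaryProj K o x + t • u ∈ K} := by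
    have h3 : x + t • u = gaugeAt K o x • ((gaugeAt K o x)⁻¹ • x + (t / gaugeAt K o x) • u) := by
      rw [smul_add, smul_inv_smul₀ hg.ne', smul_smul, mul_div_cancel₀ _ hg.ne']
    rw [h3, gaugeAt_smul _ _ hg.le, mul_le_iff_le_one_right hg, gaugeAt_le_one_iff ho,
      mem_ofPred_eq, boundaryProj, add_assoc]
  rw [mem_ofPred_eq, h2, h1, mem_Icc, mem_Icc, le_div_iff₀ hg, div_le_iff₀ hg, neg_mul,
    mul_comm, mul_comm (radialFn K _ u)]

theorem sublevelChord_eq (ho : o ∈ interior (K : Set (E n))) {x : E n} (hx : x ≠ 0) {u : E n}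
    (hu : ‖u‖ = 1) :
    sublevelChord K o x u = gaugeAt K o x * radialFn K (boundaryProj K o x) u +
      gaugeAt K o x * radialFn K (boundaryProj K o x) (-u) := by
  have hz := K.isClosed.frontier_subset (boundaryProj_mem_frontier ho hx)
  have h1 := radialFn_nonneg hz hu
  have h2 := radialFn_nonneg hz (u := -u) (by simpa using hu)
  have h3 := gaugeAt_nonneg K o x
  rw [sublevelChord, sublevel_eq_Icc ho hx hu, Real.volume_real_Icc_of_le
    (by nlinarith [mul_nonneg h3 h1, mul_nonneg h3 h2])]
  ring

theorem measurable_sublevelChord (ho : o ∈ interior (K : Set (E n))) :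
    Measurable fun p : E n × S n => sublevelChord K o p.1 p.2 := by
  have hg := (continuous_gaugeAt ho)
  have hs : MeasurableSet {p : (E n × S n) × ℝ |
      gaugeAt K o (p.1.1 + p.2 • (p.1.2 : E n)) ≤ gaugeAt K o p.1.1} :=
    (isClosed_le (by fun_prop) (by fun_prop)).measurableSet
  exact (measurable_measure_prodMk_left hs).ennreal_toReal

theorem measurable_sublevelChord_left (ho : o ∈ interior (K : Set (E n))) (u : S n) :
    Measurable fun x : E n => sublevelChord K o x u := by
  have hg := continuous_gaugeAt ho
  have hs : MeasurableSet {p : E n × ℝ |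
      gaugeAt K o (p.1 + p.2 • (u : E n)) ≤ gaugeAt K o p.1} :=
    (isClosed_le (by fun_prop) (by fun_prop)).measurableSet
  exact (measurable_measure_prodMk_left hs).ennreal_toReal

/-- The set of pairs `(x, u)` such that the gauge may be constant near `x` in direction `u`. -/
def flatSet (K : ConvexBody (E n)) (o : E n) : Set (E n × S n) :=
  {p | p.1 = 0 ∨ boundaryProj K o p.1 ∈ K ∧ 0 < radialFn K (boundaryProj K o p.1) p.2 ∧
    0 < radialFn K (boundaryProj K o p.1) (-p.2)}

theorem measurableSet_flatSet (ho : o ∈ interior (K : Set (E n))) :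
    MeasurableSet (flatSet K o) := by
  classical
  have hP := measurable_boundaryProj ho
  have hneg : Measurable fun u : S n => -u := continuous_neg.measurable
  have h1 : Measurable fun p : E n × S n => (boundaryProj K o p.1, p.2) := by fun_prop
  have h2 : Measurable fun p : E n × S n => (boundaryProj K o p.1, -p.2) := by fun_prop
  have h3 := (measurable_radialFn K).comp h1
  have h4 := (measurable_radialFn K).comp h2
  have : flatSet K o = {p | p.1 = 0} ∪ ((fun p : E n × S n => boundaryProj K o p.1) ⁻¹' K ∩
      ({p | 0 < (if boundaryProj K o p.1 ∈ K then radialFn K (boundaryProj K o p.1) p.2 else 0)} ∩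
      {p | 0 < (if boundaryProj K o p.1 ∈ K then
        radialFn K (boundaryProj K o p.1) ((-p.2 : S n) : E n) else 0)})) := by
    ext p
    by_cases h : boundaryProj K o p.1 ∈ K <;> simp [flatSet, h]
  rw [this]
  exact (measurableSet_eq_fun measurable_fst measurable_const).union
    ((K.isClosed.measurableSet.preimage (by fun_prop)).inter
    ((measurableSet_lt measurable_const h3).inter (measurableSet_lt measurable_const h4)))

/-- Let v be a normal at the projection of x. A direction with positive radial function satisfies
⟪u, v⟫ ≤ 0; if both u and -u do, then u is orthogonal to v, a null event. -/
theorem ae_notMem_flatSet (ho : o ∈ interior (K : Set (E n))) {x : E n} (hx : x ≠ 0) :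
    ∀ᵐ u ∂(sphereMeasure n), (x, u) ∉ flatSet K o := by
  have hz := boundaryProj_mem_frontier ho hx
  have hzK := K.isClosed.frontier_subset hz
  obtain ⟨v, hv⟩ := exists_isNormalAt K ⟨o, ho⟩ hz
  have hv' := (isNormalAt_iff K hzK v).1 hv
  have hside : ∀ u : S n, 0 < radialFn K (boundaryProj K o x) u → ⟪(u : E n), (v : E n)⟫ ≤ 0 := by
    intro u hu
    have h1 := hv' _ ((le_radialFn_iff hzK (norm_eq_of_mem_sphere u) hu.le).1 le_rfl)
    rw [inner_add_right, inner_smul_right] at h1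
    rw [real_inner_comm]
    by_contra! h2
    have := mul_pos hu h2
    linarith
  have hnull := sphereMeasure_orthogonal (ne_zero_of_mem_unit_sphere v)
  refine measure_mono_null (fun u hu => ?_) hnull
  rw [mem_compl_iff, mem_ofPred_eq, not_not] at hu
  rcases hu with h | ⟨-, h1, h2⟩
  · exact absurd h hx
  · have h3 := hside u h1
    have h4 := hside (-u) h2
    simp only [coe_neg_sphere, inner_neg_left] at h4
    rw [mem_ofPred_eq]
    linarith

/-- The conclusion is membership, despite the name. It is applied to the middle one of three points
of a line on the same gauge level. -/
theorem notMem_flatSet_of_le_le (ho : o ∈ interior (K : Set (E n))) {x : E n} {u : S n} {s t : ℝ}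
    (hs : 0 < s) (ht : 0 < t) (h1 : gaugeAt K o (x + s • (u : E n)) ≤ gaugeAt K o x)
    (h2 : gaugeAt K o (x + (-t) • (u : E n)) ≤ gaugeAt K o x) : (x, u) ∈ flatSet K o := by
  rcases eq_or_ne x 0 with hx | hx
  · exact Or.inl hx
  have hI := sublevel_eq_Icc ho hx (norm_eq_of_mem_sphere u)
  have h3 : s ∈ {t : ℝ | gaugeAt K o (x + t • (u : E n)) ≤ gaugeAt K o x} := h1
  have h4 : -t ∈ {t : ℝ | gaugeAt K o (x + t • (u : E n)) ≤ gaugeAt K o x} := h2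
  rw [hI] at h3 h4
  have hg := gaugeAt_pos ho hx
  refine Or.inr ⟨K.isClosed.frontier_subset (boundaryProj_mem_frontier ho hx), ?_, ?_⟩
  · exact pos_of_mul_pos_right (hs.trans_le h3.2) hg.le
  · exact pos_of_mul_pos_right (ht.trans_le (neg_le_neg_iff.1 h4.1)) hg.le

/-- Symmetrization of the integral over directions. -/
theorem two_mul_lintegral_posPow_radialFn (p : ℝ) (ho : o ∈ interior (K : Set (E n))) {x : E n}
    (hx : x ≠ 0) :
    2 * ∫⁻ u : S n, posPow p (gaugeAt K o x * radialFn K (boundaryProj K o x) u)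
      ∂(sphereMeasure n) = ∫⁻ u : S n, posPow p (sublevelChord K o x u) ∂(sphereMeasure n) := by
  have hz := K.isClosed.frontier_subset (boundaryProj_mem_frontier ho hx)
  have hm : Measurable fun u : S n =>
      posPow p (gaugeAt K o x * radialFn K (boundaryProj K o x) u) :=
    (measurable_posPow p).comp ((measurable_radialFn_of_mem hz).const_mul _)
  have hneg := measurePreserving_neg_sphereMeasure.lintegral_comp hm
  rw [two_mul]
  -- One of the two copies of the integral is reflected by u ↦ -u, so that the two ends of the chord
  -- appear together.
  nth_rw 1 [← hneg]
  rw [← lintegral_add_right _ hm]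
  refine lintegral_congr_ae ?_
  filter_upwards [ae_notMem_flatSet ho hx] with u hu
  have h1 := radialFn_nonneg hz (norm_eq_of_mem_sphere u)
  have h2 := radialFn_nonneg hz (norm_eq_of_mem_sphere (-u))
  have hg := gaugeAt_pos ho hx
  rw [sublevelChord_eq ho hx (norm_eq_of_mem_sphere u), add_comm (posPow _ _)]
  refine posPow_add p (mul_nonneg hg.le h1) (mul_nonneg hg.le h2) ?_
  by_contra! h3
  refine hu (Or.inr ⟨hz, lt_of_le_of_ne h1 ?_, lt_of_le_of_ne h2 ?_⟩)
  · exact (right_ne_zero_of_mul h3.1).symm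
  · exact (right_ne_zero_of_mul h3.2).symm

end Sublevel

/-! ### From the boundary to lines -/

/-- The boundary integral as an integral of chord lengths of the dilates of the body. -/
theorem two_mul_lintegral_regularBoundary (hn : 1 ≤ n) (ho : o ∈ interior (K : Set (E n))) {p : ℝ}
    (hp : 0 < n + p) :
    2 * (n * ∫⁻ z : regularBoundary K, ENNReal.ofReal (supportAt K o (gaussMap K z)) *
      dualQuermass p K z ∂(μHE[n - 1])) =
    ENNReal.ofReal (n + p) * ∫⁻ x in {x | gaugeAt K o x ≤ 1}, ∫⁻ u : S n,
      posPow p (sublevelChord K o x u) ∂(sphereMeasure n) := by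
  have hP := measurable_boundaryProj ho
  have hΦ := measurable_dualQuermassExt p K
  have hg := (continuous_gaugeAt ho).measurable
  have hn0 : (n : ℝ≥0∞) ≠ 0 := by simpa using Nat.ne_zero_of_lt hn
  have h1 : ∀ z : regularBoundary K, dualQuermass p K z = dualQuermassExt p K z := fun z =>
    dualQuermass_eq_dualQuermassExt p (K.isClosed.frontier_subset z.2.1)
  simp_rw [h1]
  -- The weight g^p produced here turns the p-th power of the radial function at the projection into
  -- the one for the dilate through x.
  rw [lintegral_regularBoundary_supportAt hn ho hΦ,
    ← lintegral_gauge_rpow hn hg (fun x hx => gaugeAt_pos ho hx)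
      (fun t ht x => gaugeAt_smul K o ht x) (f := fun x => dualQuermassExt p K (boundaryProj K o x))
      (by fun_prop) (fun t ht x => by rw [boundaryProj_smul K o ht]) hp]
  have h2 : 2 * (n * ∫⁻ x in {x | gaugeAt K o x ≤ 1},
      ENNReal.ofReal (gaugeAt K o x ^ p) * dualQuermassExt p K (boundaryProj K o x)) =
      ∫⁻ x in {x | gaugeAt K o x ≤ 1}, ∫⁻ u : S n,
      posPow p (sublevelChord K o x u) ∂(sphereMeasure n) := by
    rw [← lintegral_const_mul' _ _ (by simp), ← lintegral_const_mul' _ _ (by simp)]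
    refine lintegral_congr_ae (ae_restrict_of_ae ?_)
    have : Nontrivial (E n) := by
      have : Nonempty (Fin n) := ⟨⟨0, hn⟩⟩
      infer_instance
    have h0 : ∀ᵐ x : E n, x ≠ 0 := by simp [ae_iff]
    filter_upwards [h0] with x hx
    rw [← two_mul_lintegral_posPow_radialFn p ho hx, dualQuermassExt_eq_of_mem p
      (K.isClosed.frontier_subset (boundaryProj_mem_frontier ho hx))]
    simp_rw [posPow_mul p (gaugeAt_pos ho hx)]
    rw [lintegral_const_mul' _ _ ENNReal.ofReal_ne_top, mul_left_comm (n : ℝ≥0∞),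
      ← mul_assoc (n : ℝ≥0∞), ENNReal.mul_inv_cancel hn0 (by simp), one_mul]
  rw [← h2]
  ring

/-- On a line on which the gauge has no flat pieces, the chord lengths of the dilates are uniformly
distributed. -/
theorem lintegral_line_posPow_sublevelChord {q : ℝ} (hq : 0 < q)
    (ho : o ∈ interior (K : Set (E n))) (y : E n) (u : S n)
    (hflat : ∀ᵐ s : ℝ, (y + s • (u : E n) - o, u) ∉ flatSet K o) :
    ∫⁻ s in {s : ℝ | y + s • (u : E n) ∈ K},
      posPow (q - 1) (sublevelChord K o (y + s • (u : E n) - o) u) =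
    ENNReal.ofReal (volume.real {s : ℝ | y + s • (u : E n) ∈ K} ^ q / q) := by
  set A : Set ℝ := {s : ℝ | y + s • (u : E n) ∈ K} with hA
  set φ : ℝ → ℝ := fun s => gaugeAt K o (y + s • (u : E n) - o) with hφ
  have hcompact : IsCompact A := isCompact_chord K y (norm_eq_of_mem_sphere u)
  have : IsFiniteMeasure (volume.restrict A) := ⟨by simpa using hcompact.measure_lt_top⟩
  have hg := continuous_gaugeAt ho
  have hφc : Continuous φ := by fun_prop
  have hAφ : A = {s | φ s ≤ 1} := by
    ext s
    simp only [hA, hφ, mem_ofPred_eq, gaugeAt_le_one_iff ho, add_sub_cancel]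
  -- Outside the null set of flat points a level set has at most two points: with three, the middle
  -- one would be flat.
  have hlevel : ∀ r, (volume.restrict A) {s | φ s = r} = 0 := by
    intro r
    have h1 : {s | φ s = r} ⊆ {s | ¬ (y + s • (u : E n) - o, u) ∉ flatSet K o} ∪
        {s | φ s = r ∧ (y + s • (u : E n) - o, u) ∉ flatSet K o} := by
      intro s hs
      by_cases h : (y + s • (u : E n) - o, u) ∈ flatSet K o
      · exact Or.inl (not_not.2 h)
      · exact Or.inr ⟨hs, h⟩
    have hmid : ∀ a b c : ℝ, a < b → b < c → φ a = r → φ b = r → φ c = r →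
        (y + b • (u : E n) - o, u) ∈ flatSet K o := by
      intro a b c hab hbc ha hb hc
      refine notMem_flatSet_of_le_le ho (s := c - b) (t := b - a) (by linarith) (by linarith) ?_ ?_
      · rw [show y + b • (u : E n) - o + (c - b) • (u : E n) = y + c • (u : E n) - o by module]
        exact (hc.trans hb.symm).le
      · rw [show y + b • (u : E n) - o + (-(b - a)) • (u : E n) = y + a • (u : E n) - o by module]
        exact (ha.trans hb.symm).le
    have h2 : {s | φ s = r ∧ (y + s • (u : E n) - o, u) ∉ flatSet K o}.Finite := by
      rcases Set.subsingleton_or_nontrivial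
        {s | φ s = r ∧ (y + s • (u : E n) - o, u) ∉ flatSet K o} with h | h
      · exact h.finite
      · obtain ⟨a, ha, b, hb, hab⟩ := h.exists_lt
        refine (Set.toFinite {a, b}).subset fun c hc => ?_
        rcases lt_trichotomy c a with h3 | h3 | h3
        · exact absurd (hmid c a b h3 hab hc.1 ha.1 hb.1) ha.2
        · exact Or.inl h3
        rcases lt_trichotomy c b with h4 | h4 | h4
        · exact absurd (hmid a c b h3 h4 ha.1 hc.1 hb.1) hc.2
        · exact Or.inr h4
        · exact absurd (hmid a b c hab h4 ha.1 hb.1 hc.1) hb.2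
    have h3 : volume {s | φ s = r} = 0 :=
      measure_mono_null h1 (measure_union_null hflat (h2.measure_zero _))
    exact le_antisymm ((Measure.restrict_apply_le _ _).trans h3.le) zero_le
  have hmap := map_measureReal_sublevel (volume.restrict A) hφc.measurable hlevel
  -- After translating by s, the chord of the dilate is a sublevel set of φ, so its length is the
  -- distribution function of φ at φ s.
  have hchord : ∀ s ∈ A, sublevelChord K o (y + s • (u : E n) - o) u =
      (volume.restrict A).real {s' | φ s' ≤ φ s} := by
    intro s hs
    have h1 : {s' | φ s' ≤ φ s} ⊆ A := by
      rw [hAφ] at hs ⊢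
      exact fun s' (hs' : φ s' ≤ φ s) => hs'.trans hs
    have h2 : {t : ℝ | gaugeAt K o (y + s • (u : E n) - o + t • (u : E n)) ≤
        gaugeAt K o (y + s • (u : E n) - o)} = (fun t => s + t) ⁻¹' {s' | φ s' ≤ φ s} := by
      ext t
      rw [mem_ofPred_eq, mem_preimage, mem_ofPred_eq, hφ]
      simp only
      rw [show y + s • (u : E n) - o + t • (u : E n) = y + (s + t) • (u : E n) - o by module]
    rw [sublevelChord, h2, measureReal_def, measure_preimage_add, measureReal_def,
      Measure.restrict_eq_self _ h1]
  have hFm : Measurable fun s => (volume.restrict A).real {s' | φ s' ≤ φ s} := by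
    have h1 : Monotone fun r => (volume.restrict A).real {s' | φ s' ≤ r} := fun a b hab =>
      measureReal_mono fun s (hs : φ s ≤ a) => hs.trans hab
    exact h1.measurable.comp hφc.measurable
  rw [setLIntegral_congr_fun hcompact.measurableSet fun s hs => by rw [hchord s hs],
    ← lintegral_map (measurable_posPow (q - 1)) hFm, hmap, measureReal_restrict_apply_univ,
    setLIntegral_congr_fun measurableSet_Ioc fun t ht => posPow_of_pos (q - 1) ht.1,
    lintegral_Ioc_rpow (by linarith) measureReal_nonneg, sub_add_cancel]

/-- Almost every line of a given direction meets a null set in a null set. -/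
theorem ae_lines_ae_notMem {u : E n} (hu1 : ‖u‖ = 1) {F : Set (E n)} (hF : MeasurableSet F)
    (hF0 : ∀ᵐ x, x ∉ F) (o : E n) :
    ∀ᵐ y ∂((μHE[n - 1] : Measure (E n)).restrict ((ℝ ∙ u)ᗮ : Set (E n))),
      ∀ᵐ s : ℝ, y + s • u - o ∉ F := by
  have hind : Measurable (fun a : E n => (F.indicator (1 : E n → ℝ≥0∞)) (a - o)) :=
    (measurable_one.indicator hF).comp (measurable_sub_const o)
  have h1 := lintegral_eq_lintegral_lines hu1 hind
  rw [lintegral_sub_right_eq_self, lintegral_indicator_one hF] at h1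
  have h2 : volume F = 0 := by simpa [ae_iff] using hF0
  rw [h2] at h1
  have h3 : Measurable fun y : E n => ∫⁻ s : ℝ, (F.indicator (1 : E n → ℝ≥0∞)) (y + s • u - o) := by
    have h4 : Measurable fun p : E n × ℝ => (F.indicator (1 : E n → ℝ≥0∞)) (p.1 + p.2 • u - o) :=
      (measurable_one.indicator hF).comp (by fun_prop)
    exact h4.lintegral_prod_right'
  filter_upwards [(lintegral_eq_zero_iff h3).1 h1.symm] with y hy
  have h6 := (lintegral_eq_zero_iff (hind.comp
    (by fun_prop : Measurable fun s : ℝ => y + s • u))).1 hy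
  filter_upwards [h6] with s hs hmem
  simp [indicator_of_mem hmem] at hs

/-- For each nonzero x almost every u is good; measurability of `flatSet` allows the two quantifiers
to be exchanged. -/
theorem ae_ae_notMem_flatSet (hn : 1 ≤ n) (ho : o ∈ interior (K : Set (E n))) :
    ∀ᵐ u ∂(sphereMeasure n), ∀ᵐ x : E n, (x, u) ∉ flatSet K o := by
  have : Nontrivial (E n) := by
    have : Nonempty (Fin n) := ⟨⟨0, hn⟩⟩
    infer_instance
  have h0 : ∀ᵐ x : E n, x ≠ 0 := by simp [ae_iff]
  have hcomm := Measure.ae_ae_comm (μ := (volume : Measure (E n))) (ν := sphereMeasure n)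
    (p := fun x u => (x, u) ∉ flatSet K o) (measurableSet_flatSet ho).compl
  exact hcomm.1 (h0.mono fun x hx => ae_notMem_flatSet ho hx)

/-- After translation by o, Fubini splits the integral over the lines parallel to u, and each
generic line contributes L^q / q. -/
theorem lintegral_posPow_sublevelChord_direction {q : ℝ} (hq : 0 < q)
    (ho : o ∈ interior (K : Set (E n))) {u : S n} (hu : ∀ᵐ x : E n, (x, u) ∉ flatSet K o) :
    ∫⁻ x in {x | gaugeAt K o x ≤ 1}, posPow (q - 1) (sublevelChord K o x u) =
    ENNReal.ofReal q⁻¹ * ∫⁻ y in ((ℝ ∙ (u : E n))ᗮ : Set (E n)),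
      ENNReal.ofReal (volume.real {s : ℝ | y + s • (u : E n) ∈ K} ^ q) ∂(μHE[n - 1]) := by
  have hMu : Measurable fun x : E n => posPow (q - 1) (sublevelChord K o x u) :=
    (measurable_posPow _).comp (measurable_sublevelChord_left ho u)
  have hgm : MeasurableSet {x | gaugeAt K o x ≤ 1} :=
    (isClosed_le (continuous_gaugeAt ho) continuous_const).measurableSet
  have hFu : MeasurableSet {x : E n | (x, u) ∈ flatSet K o} :=
    (measurableSet_flatSet ho).preimage (by fun_prop : Measurable fun x : E n => (x, u))
  have hu1 : ‖(u : E n)‖ = 1 := norm_eq_of_mem_sphere u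
  have hlines := ae_lines_ae_notMem hu1 hFu hu o
  have hf : Measurable fun a : E n => ({x | gaugeAt K o x ≤ 1}.indicator
      fun x => posPow (q - 1) (sublevelChord K o x u)) (a - o) :=
    (hMu.indicator hgm).comp (measurable_sub_const o)
  rw [← lintegral_indicator hgm, ← lintegral_sub_right_eq_self _ o,
    lintegral_eq_lintegral_lines hu1 hf, ← lintegral_const_mul' _ _ ENNReal.ofReal_ne_top]
  refine lintegral_congr_ae ?_
  filter_upwards [hlines] with y hy
  rw [← ENNReal.ofReal_mul (by positivity), ← div_eq_inv_mul,
    ← lintegral_line_posPow_sublevelChord hq ho y u hy, ← lintegral_indicator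
      ((isCompact_chord K y hu1).measurableSet)]
  refine lintegral_congr fun s => ?_
  have hiff : gaugeAt K o (y + s • (u : E n) - o) ≤ 1 ↔ y + s • (u : E n) ∈ K := by
    rw [gaugeAt_le_one_iff ho, add_sub_cancel]
  by_cases h : y + s • (u : E n) ∈ K
  · rw [indicator_of_mem (by exact hiff.2 h), indicator_of_mem (by exact h)]
  · rw [indicator_of_notMem (by exact mt hiff.1 h), indicator_of_notMem (by exact h)]

/-- The integral over points and directions as an integral over lines. -/
theorem lintegral_posPow_sublevelChord {q : ℝ} (hq : 0 < q) (hn : 1 ≤ n)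
    (ho : o ∈ interior (K : Set (E n))) :
    ∫⁻ x in {x | gaugeAt K o x ≤ 1}, ∫⁻ u : S n,
      posPow (q - 1) (sublevelChord K o x u) ∂(sphereMeasure n) =
    ENNReal.ofReal q⁻¹ * ∫⁻ u : S n, ∫⁻ y in ((ℝ ∙ (u : E n))ᗮ : Set (E n)),
      ENNReal.ofReal (volume.real {s : ℝ | y + s • (u : E n) ∈ K} ^ q)
        ∂(μHE[n - 1]) ∂(sphereMeasure n) := by
  have hM : Measurable fun p : E n × S n => posPow (q - 1) (sublevelChord K o p.1 p.2) :=
    (measurable_posPow _).comp (measurable_sublevelChord ho)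
  rw [lintegral_lintegral_swap hM.aemeasurable, ← lintegral_const_mul' _ _ ENNReal.ofReal_ne_top]
  exact lintegral_congr_ae ((ae_ae_notMem_flatSet hn ho).mono fun u hu =>
    lintegral_posPow_sublevelChord_direction hq ho hu)

/-- Lines are parametrized isometrically, and the restriction to lines meeting `K` disappears
because 0^q = 0 for q > 0. -/
theorem chordIntegral_eq {q : ℝ} (hq : 0 < q) (K : ConvexBody (E n)) :
    chordIntegral q K = (ENNReal.ofReal (n * omega n))⁻¹ *
      ∫⁻ u : S n, ∫⁻ y in ((ℝ ∙ (u : E n))ᗮ : Set (E n)),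
        ENNReal.ofReal (volume.real {s : ℝ | y + s • (u : E n) ∈ K} ^ q)
          ∂(μHE[n - 1]) ∂(sphereMeasure n) := by
  rw [chordIntegral, lintegralLines]
  congr 1
  refine lintegral_congr fun u => lintegral_congr fun y => ?_
  have hu1 : ‖(u : E n)‖ = 1 := norm_eq_of_mem_sphere u
  have hline : (K : Set (E n)) ∩ AffineSubspace.mk' y (ℝ ∙ (u : E n)) =
      (fun s : ℝ => y + s • (u : E n)) '' {s : ℝ | y + s • (u : E n) ∈ K} := by
    ext a
    simp only [mem_inter_iff, SetLike.mem_coe, AffineSubspace.mem_mk', vsub_eq_sub,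
      Submodule.mem_span_singleton, mem_image, mem_ofPred_eq]
    constructor
    · rintro ⟨ha, s, hs⟩
      have : y + s • (u : E n) = a := by rw [hs]; abel
      exact ⟨s, this ▸ ha, this⟩
    · rintro ⟨s, hs, rfl⟩
      exact ⟨hs, s, by simp⟩
  have hiso : Isometry fun s : ℝ => y + s • (u : E n) := by
    refine Isometry.of_dist_eq fun s t => ?_
    rw [dist_add_left, dist_eq_norm, ← sub_smul, norm_smul, hu1, mul_one, dist_eq_norm]
  have hvol : (μHE[1] : Measure ℝ) = volume := by
    have := InnerProductSpace.euclideanHausdorffMeasure_eq_volume (V := ℝ)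
    rwa [finrank_self] at this
  by_cases hne : ((K : Set (E n)) ∩ AffineSubspace.mk' y (ℝ ∙ (u : E n))).Nonempty
  · rw [indicator_of_mem (by exact hne), hline, hiso.euclideanHausdorffMeasure_image, hvol,
      ← ENNReal.ofReal_rpow_of_nonneg measureReal_nonneg hq.le,
      ofReal_measureReal (isCompact_chord K y hu1).measure_lt_top.ne]
  · rw [indicator_of_notMem (by exact hne)]
    rw [hline, image_nonempty, not_nonempty_iff_eq_empty] at hne
    rw [hne]
    simp [Real.zero_rpow hq.ne']

theorem omega_pos (n : ℕ) : 0 < omega n :=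
  ENNReal.toReal_pos (measure_closedBall_pos _ _ one_pos).ne' measure_closedBall_lt_top.ne

/-- The chord integral as a boundary integral, with an interior point as the base point. -/
theorem chordIntegral_eq_lintegral_regularBoundary {q : ℝ} (hq : 0 < q) (hn : 1 ≤ n)
    (ho : o ∈ interior (K : Set (E n))) :
    chordIntegral q K = ENNReal.ofReal (2 * q / ((n + q - 1) * omega n)) *
      ∫⁻ z : regularBoundary K, ENNReal.ofReal (supportAt K o (gaussMap K z)) *
        dualQuermass (q - 1) K z ∂(μHE[n - 1]) := by
  have hn1 : (1 : ℝ) ≤ n := by exact_mod_cast hn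
  have hω := omega_pos n
  have hnq : 0 < (n : ℝ) + q - 1 := by linarith
  have h1 := two_mul_lintegral_regularBoundary hn ho (p := q - 1) (by linarith)
  rw [lintegral_posPow_sublevelChord hq hn ho] at h1
  rw [chordIntegral_eq hq]
  set J := ∫⁻ u : S n, ∫⁻ y in ((ℝ ∙ (u : E n))ᗮ : Set (E n)),
        ENNReal.ofReal (volume.real {s : ℝ | y + s • (u : E n) ∈ K} ^ q)
          ∂(μHE[n - 1]) ∂(sphereMeasure n)
  set B := ∫⁻ z : regularBoundary K, ENNReal.ofReal (supportAt K o (gaussMap K z)) *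
        dualQuermass (q - 1) K z ∂(μHE[n - 1])
  have h2 : ENNReal.ofReal (2 * n) * B =
      ENNReal.ofReal ((n + (q - 1)) * q⁻¹) * J := by
    rw [ENNReal.ofReal_mul (by norm_num), ENNReal.ofReal_mul (by linarith), mul_assoc, mul_assoc,
      ← h1]
    simp
  rw [← ENNReal.ofReal_inv_of_pos (by positivity)]
  have h3 : ENNReal.ofReal (2 * q / ((n + q - 1) * omega n)) =
      ENNReal.ofReal (q / ((n + q - 1) * (n * omega n))) * ENNReal.ofReal (2 * n) := by
    rw [← ENNReal.ofReal_mul (by positivity)]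
    congr 1
    field_simp
  rw [h3, mul_assoc, h2, ← mul_assoc, ← ENNReal.ofReal_mul (by positivity)]
  congr 2
  rw [← add_sub_assoc]
  field_simp

/-! ### Finiteness of the chord integral -/

/-- Thickening the flat ball by a unit segment in direction u stays inside the ball of radius R + 1.
The bound is uniform in u. -/
theorem restrict_orthogonal_closedBall_le {u : E n} (hu : ‖u‖ = 1) (R : ℝ) :
    (μHE[n - 1] : Measure (E n)).restrict ((ℝ ∙ u)ᗮ : Set (E n)) (closedBall 0 R) ≤
      volume (closedBall (0 : E n) (R + 1)) := by
  have hm : MeasurableSet (closedBall (0 : E n) (R + 1)) := measurableSet_closedBall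
  rw [← lintegral_indicator_one hm,
    lintegral_eq_lintegral_lines hu (measurable_one.indicator hm),
    ← lintegral_indicator_one measurableSet_closedBall]
  refine lintegral_mono (indicator_le fun y hy => ?_)
  have h1 : (Icc (0 : ℝ) 1).indicator (1 : ℝ → ℝ≥0∞) ≤ fun s =>
      (closedBall (0 : E n) (R + 1)).indicator 1 (y + s • u) := by
    refine indicator_le fun s hs => ?_
    rw [indicator_of_mem]
    · rfl
    · rw [mem_closedBall_zero_iff] at hy ⊢
      refine (norm_add_le _ _).trans (add_le_add hy ?_)
      rw [norm_smul, hu, mul_one, Real.norm_of_nonneg hs.1]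
      exact hs.2
  calc (1 : E n → ℝ≥0∞) y = ∫⁻ s, (Icc (0 : ℝ) 1).indicator 1 s := by
        rw [lintegral_indicator_one measurableSet_Icc]
        simp
    _ ≤ _ := lintegral_mono h1

theorem chordIntegral_ne_top {q : ℝ} (hq : 0 < q) (hn : 1 ≤ n) (K : ConvexBody (E n)) :
    chordIntegral q K ≠ ∞ := by
  obtain ⟨R, hR0, hR⟩ := exists_subset_closedBall K 0
  simp only [sub_zero] at hR
  have hω := omega_pos n
  have hn0 : (0 : ℝ) < n := by exact_mod_cast hn
  have hchord : ∀ u : S n, ∀ y ∈ ((ℝ ∙ (u : E n))ᗮ : Set (E n)),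
      ENNReal.ofReal (volume.real {s : ℝ | y + s • (u : E n) ∈ K} ^ q) ≤
      (closedBall (0 : E n) R).indicator (fun _ => ENNReal.ofReal ((2 * R) ^ q)) y := by
    intro u y hy
    have hu1 : ‖(u : E n)‖ = 1 := norm_eq_of_mem_sphere u
    have hyu : ⟪y, (u : E n)⟫ = 0 := Submodule.mem_orthogonal_singleton_iff_inner_left.1 hy
    -- Pythagoras bounds both the foot y of a line meeting `K` and the parameters of its chord by R.
    have hpyth : ∀ s : ℝ, y + s • (u : E n) ∈ K → ‖y‖ ^ 2 + s ^ 2 ≤ R ^ 2 := by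
      intro s hs
      have h1 := norm_add_sq_real y (s • (u : E n))
      rw [inner_smul_right, hyu, norm_smul, hu1, mul_one, Real.norm_eq_abs, sq_abs] at h1
      have h2 := hR _ hs
      nlinarith [norm_nonneg (y + s • (u : E n))]
    by_cases hyR : y ∈ closedBall (0 : E n) R
    · rw [indicator_of_mem hyR]
      refine ENNReal.ofReal_le_ofReal (Real.rpow_le_rpow measureReal_nonneg ?_ hq.le)
      have h1 : {s : ℝ | y + s • (u : E n) ∈ K} ⊆ Icc (-R) R := fun s hs => by
        rw [mem_Icc, ← abs_le]
        exact abs_le_of_sq_le_sq (by nlinarith [hpyth s hs, sq_nonneg ‖y‖]) hR0.le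
      refine (measureReal_mono h1 measure_Icc_lt_top.ne).trans (le_of_eq ?_)
      rw [Real.volume_real_Icc_of_le (by linarith)]
      ring
    · have h1 : {s : ℝ | y + s • (u : E n) ∈ K} = ∅ := by
        refine eq_empty_of_forall_notMem fun s hs => hyR ?_
        rw [mem_closedBall_zero_iff]
        exact le_of_sq_le_sq (by nlinarith [hpyth s hs, sq_nonneg s]) hR0.le
      rw [h1]
      simp [Real.zero_rpow hq.ne']
  rw [chordIntegral_eq hq]
  refine ENNReal.mul_ne_top (ENNReal.inv_ne_top.2
    (ENNReal.ofReal_pos.2 (by positivity)).ne') ?_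
  have hbound : ∀ u : S n, ∫⁻ y in ((ℝ ∙ (u : E n))ᗮ : Set (E n)),
      ENNReal.ofReal (volume.real {s : ℝ | y + s • (u : E n) ∈ K} ^ q) ∂(μHE[n - 1]) ≤
      ENNReal.ofReal ((2 * R) ^ q) * volume (closedBall (0 : E n) (R + 1)) := by
    intro u
    refine (setLIntegral_mono' (Submodule.closed_of_finiteDimensional _).measurableSet
      (hchord u)).trans ?_
    rw [lintegral_indicator_const measurableSet_closedBall]
    exact mul_le_mul_right (restrict_orthogonal_closedBall_le (norm_eq_of_mem_sphere u) R) _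
  refine ((lintegral_mono hbound).trans_lt ?_).ne
  rw [lintegral_const]
  exact ENNReal.mul_lt_top (ENNReal.mul_lt_top ENNReal.ofReal_lt_top measure_closedBall_lt_top)
    (measure_lt_top _ _)

/-! ### The chord measure and removal of the base point -/

theorem measurable_dualQuermass (p : ℝ) (K : ConvexBody (E n)) :
    Measurable fun z : regularBoundary K => dualQuermass p K z := by
  have h : (fun z : regularBoundary K => dualQuermass p K z) =
      fun z : regularBoundary K => dualQuermassExt p K z := by
    ext z
    exact dualQuermass_eq_dualQuermassExt p (K.isClosed.frontier_subset z.2.1)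
  rw [h]
  exact (measurable_dualQuermassExt p K).comp measurable_subtype_coe

/-- Integration with respect to the chord measure as a boundary integral. -/
theorem lintegral_chordMeasure {q : ℝ} (hq : 0 < q) (hn : 1 ≤ n) {k : S n → ℝ≥0∞}
    (hk : Measurable k) :
    ENNReal.ofReal (1 / (n + q - 1)) * ∫⁻ v, k v ∂(chordMeasure q K) =
      ENNReal.ofReal (2 * q / ((n + q - 1) * omega n)) *
        ∫⁻ z : regularBoundary K, k (gaussMap K z) * dualQuermass (q - 1) K z
          ∂(μHE[n - 1]) := by
  have hn1 : (1 : ℝ) ≤ n := by exact_mod_cast hn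
  have hω := omega_pos n
  have hnq : 0 < (n : ℝ) + q - 1 := by linarith
  have hm := (continuous_gaussMap K).measurable
  have hd := (measurable_dualQuermass (q - 1) K).const_mul (ENNReal.ofReal (2 * q / omega n))
  rw [chordMeasure, lintegral_map hk hm,
    lintegral_withDensity_eq_lintegral_mul _ hd (g := fun z => k (gaussMap K z)) (hk.comp hm)]
  have h1 : ∀ z : regularBoundary K, ((fun z : regularBoundary K =>
      ENNReal.ofReal (2 * q / omega n) * dualQuermass (q - 1) K z) *
      fun z => k (gaussMap K z)) z =
      ENNReal.ofReal (2 * q / omega n) * (k (gaussMap K z) * dualQuermass (q - 1) K z) := by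
    intro z
    simp only [Pi.mul_apply]
    ring
  simp_rw [h1]
  rw [lintegral_const_mul' _ _ ENNReal.ofReal_ne_top, ← mul_assoc,
    ← ENNReal.ofReal_mul (by positivity)]
  congr 2
  field_simp

theorem continuous_supportAt (K : ConvexBody (E n)) (o : E n) : Continuous (supportAt K o) := by
  have := continuous_supportFn K
  unfold supportAt
  fun_prop

theorem chordIntegral_eq_lintegral_supportAt {q : ℝ} (hq : 0 < q) (hn : 1 ≤ n)
    (ho : o ∈ interior (K : Set (E n))) :
    chordIntegral q K = ENNReal.ofReal (1 / (n + q - 1)) *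
      ∫⁻ v : S n, ENNReal.ofReal (supportAt K o v) ∂(chordMeasure q K) := by
  have := (continuous_supportAt K o).measurable
  rw [lintegral_chordMeasure hq hn (by fun_prop), chordIntegral_eq_lintegral_regularBoundary hq hn ho]

/-- `supportAt K o` is at least the radius r of a ball around o inside `K`, and its integral is
finite because the chord integral is. -/
theorem isFiniteMeasure_chordMeasure {q : ℝ} (hq : 0 < q) (hn : 1 ≤ n)
    (hK : (interior (K : Set (E n))).Nonempty) : IsFiniteMeasure (chordMeasure q K) := by
  obtain ⟨o, ho⟩ := hK
  have hn1 : (1 : ℝ) ≤ n := by exact_mod_cast hn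
  have hnq : 0 < (n : ℝ) + q - 1 := by linarith
  obtain ⟨r, hr, hb⟩ := exists_ball_subset ho
  have hfin := chordIntegral_ne_top hq hn K
  rw [chordIntegral_eq_lintegral_supportAt hq hn ho] at hfin
  have h1 : ∫⁻ v : S n, ENNReal.ofReal (supportAt K o v) ∂(chordMeasure q K) ≠ ∞ := by
    intro h
    rw [h, ENNReal.mul_top] at hfin
    · exact hfin rfl
    · simpa using hnq
  have h2 : ENNReal.ofReal r * chordMeasure q K univ ≤
      ∫⁻ v : S n, ENNReal.ofReal (supportAt K o v) ∂(chordMeasure q K) := by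
    rw [← lintegral_const]
    exact lintegral_mono fun v => ENNReal.ofReal_le_ofReal (le_supportAt hr hb v)
  refine ⟨lt_top_iff_ne_top.2 fun h => h1 (top_le_iff.1 ?_)⟩
  rwa [h, ENNReal.mul_top (by simpa using hr)] at h2

theorem integrable_chordMeasure {q : ℝ} (hq : 0 < q) (hn : 1 ≤ n)
    (hK : (interior (K : Set (E n))).Nonempty) {f : S n → ℝ} (hf : Continuous f) :
    Integrable f (chordMeasure q K) := by
  have := isFiniteMeasure_chordMeasure hq hn hK
  exact hf.integrable_of_hasCompactSupport (HasCompactSupport.of_compactSpace f)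

theorem toReal_chordIntegral_eq_integral_supportAt {q : ℝ} (hq : 0 < q) (hn : 1 ≤ n)
    (ho : o ∈ interior (K : Set (E n))) :
    (chordIntegral q K).toReal = 1 / (n + q - 1) *
      (∫ v : S n, supportFn K v ∂(chordMeasure q K) -
        ∫ v : S n, ⟪o, (v : E n)⟫ ∂(chordMeasure q K)) := by
  have hn1 : (1 : ℝ) ≤ n := by exact_mod_cast hn
  have hnq : 0 < (n : ℝ) + q - 1 := by linarith
  have hc := continuous_supportFn K
  rw [← integral_sub (integrable_chordMeasure hq hn ⟨o, ho⟩ (by fun_prop))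
    (integrable_chordMeasure hq hn ⟨o, ho⟩ (by fun_prop)),
    chordIntegral_eq_lintegral_supportAt hq hn ho, ENNReal.toReal_mul,
    ENNReal.toReal_ofReal (by positivity)]
  congr 1
  have hc' := continuous_supportAt K o
  rw [← integral_eq_lintegral_of_nonneg_ae (Eventually.of_forall fun v => (supportAt_pos ho v).le)
    (integrable_chordMeasure hq hn ⟨o, ho⟩ (by fun_prop)).aestronglyMeasurable]
  rfl

/-- The chord integral does not depend on the base point. Using both o and t • o, interior for some
t > 1, gives (t - 1) ∫ ⟪o, v⟫ = 0. -/
theorem integral_inner_chordMeasure {q : ℝ} (hq : 0 < q) (hn : 1 ≤ n)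
    (ho : o ∈ interior (K : Set (E n))) :
    ∫ v : S n, ⟪o, (v : E n)⟫ ∂(chordMeasure q K) = 0 := by
  have hn1 : (1 : ℝ) ≤ n := by exact_mod_cast hn
  have hnq : 0 < (n : ℝ) + q - 1 := by linarith
  have hcont : Tendsto (fun t : ℝ => t • o) (𝓝[>] 1) (𝓝 ((1 : ℝ) • o)) :=
    ((continuous_id.smul continuous_const).tendsto 1).mono_left inf_le_left
  rw [one_smul] at hcont
  obtain ⟨t, ht, ht1⟩ := ((hcont.eventually (isOpen_interior.mem_nhds ho)).and
    self_mem_nhdsWithin).exists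
  have h1 := toReal_chordIntegral_eq_integral_supportAt hq hn ho
  rw [toReal_chordIntegral_eq_integral_supportAt hq hn ht] at h1
  have h2 := mul_left_cancel₀ (by positivity : 1 / ((n : ℝ) + q - 1) ≠ 0) h1
  simp only [inner_smul_left, conj_trivial, integral_const_mul] at h2
  have h3 : (t - 1) * ∫ v : S n, ⟪o, (v : E n)⟫ ∂(chordMeasure q K) = 0 := by linarith
  exact (mul_eq_zero.1 h3).resolve_left (sub_ne_zero.2 (ne_of_gt ht1))

theorem toReal_chordIntegral {q : ℝ} (hq : 0 < q) (hn : 1 ≤ n)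
    (hK : (interior (K : Set (E n))).Nonempty) :
    (chordIntegral q K).toReal =
      1 / (n + q - 1) * ∫ v : S n, supportFn K v ∂(chordMeasure q K) := by
  obtain ⟨o, ho⟩ := hK
  rw [toReal_chordIntegral_eq_integral_supportAt hq hn ho, integral_inner_chordMeasure hq hn ho,
    sub_zero]

/-- The origin may lie on the boundary, so it cannot serve as the base point o. Membership still
makes the support function nonnegative, so `ENNReal.ofReal` truncates nothing and the formula for
real integrals transfers. -/
theorem chordIntegral_eq_coneChordMeasure {q : ℝ} (hq : 0 < q) (hn : 1 ≤ n)
    (hK : (interior (K : Set (E n))).Nonempty) (h0 : (0 : E n) ∈ K) :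
    chordIntegral q K = coneChordMeasure q K univ := by
  have hn1 : (1 : ℝ) ≤ n := by exact_mod_cast hn
  have hnq : 0 < (n : ℝ) + q - 1 := by linarith
  have hc := continuous_supportFn K
  have hnn : ∀ v : S n, 0 ≤ supportFn K v := fun v => by
    simpa using inner_le_supportFn K h0 (v : E n)
  have hint := integrable_chordMeasure hq hn hK (f := fun v => supportFn K v) (by fun_prop)
  have hspec : ∀ z : regularBoundary K, ⟪(z : E n), (gaussMap K z : E n)⟫ =
      supportFn K (gaussMap K z) := gaussMap_spec K
  have hm := hc.measurable
  rw [coneChordMeasure_apply q K .univ, preimage_univ, setLIntegral_univ]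
  simp_rw [hspec]
  rw [← lintegral_chordMeasure hq hn (k := fun v => ENNReal.ofReal (supportFn K v))
    (by fun_prop), ← ofReal_integral_eq_lintegral_ofReal hint (Eventually.of_forall hnn),
    ← ENNReal.ofReal_mul (by positivity), ← toReal_chordIntegral hq hn hK,
    ENNReal.ofReal_toReal (chordIntegral_ne_top hq hn K)]

end ChordMeasure

end

theorem theorem4p3 (n : ℕ) (hn : 1 ≤ n) (K : ConvexBody (ChordMeasure.E n))
    (hK : (interior (K : Set (ChordMeasure.E n))).Nonempty) (q : ℝ) (hq : 0 < q) :
    IsFiniteMeasure (ChordMeasure.chordMeasure q K) ∧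
    ChordMeasure.chordIntegral q K ≠ ∞ ∧
    Integrable (fun v : ChordMeasure.S n => ChordMeasure.supportFn K v)
      (ChordMeasure.chordMeasure q K) ∧
    (ChordMeasure.chordIntegral q K).toReal =
      1 / (n + q - 1) *
        ∫ v : ChordMeasure.S n, ChordMeasure.supportFn K v ∂(ChordMeasure.chordMeasure q K) ∧
    ((0 : ChordMeasure.E n) ∈ K →
      ChordMeasure.chordIntegral q K = ChordMeasure.coneChordMeasure q K Set.univ) :=
  ⟨ChordMeasure.isFiniteMeasure_chordMeasure hq hn hK, ChordMeasure.chordIntegral_ne_top hq hn K,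
    ChordMeasure.integrable_chordMeasure hq hn hK
      ((ChordMeasure.continuous_supportFn K).comp continuous_subtype_val),
    ChordMeasure.toReal_chordIntegral hq hn hK,
    ChordMeasure.chordIntegral_eq_coneChordMeasure hq hn hK⟩
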